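/- Let $\mathcal H$ be a real Hilbert space with scalar product $\langle\cdot,\cdot\rangle$ and norm $\|\cdot\|$. For $h\colon\mathcal H\to\left]-\infty,+\infty\right]$ write $\operatorname{dom}h=\{h<+\infty\}$ and $\operatorname{argmin}h=\{x: h(x)=\inf_{\mathcal H}h\}$. Assume: **H1.** $f,g\colon\mathcal H\to\left]-\infty,+\infty\right]$ are proper, convex and lower semicontinuous, and $\operatorname{dom}g\subset\operatorname{dom}f$. **H2.** $f$ is Gâteaux differentiable on $\operatorname{dom}g$, and $\nabla f$ is uniformly continuous on every weakly compact subset of $\operatorname{dom}g$. **H3.** $(\langle\cdot,\cdot\rangle_k)_{k\in\mathbb N}$ are scalar products on $\mathcal H$, $\langle\cdot,\cdot\rangle_k=\langle\cdot,W_k\,\cdot\rangle$ with $W_k$ a positive operator, with norms $\|\cdot\|_k$, and there are $0<\nu\le\mu$ with $\nu\|\cdot\|^2\le\|\cdot\|_k^2\le\mu\|\cdot\|^2$ for all $k$. Assume moreover that at least one of the following holds: **H4.** There is a summable sequence $(\eta_k)$ in $[0,+\infty[$ with $\|\cdot\|_{k+1}^2\le(1+\eta_k)\|\cdot\|_k^2$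 for all $k$. **H5.** $\sum_k(\mu_k-\nu_k)<+\infty$, where $\mu_k=\sup_{\|x\|=1}\langle x,W_kx\rangle$ and $\nu_k=\inf_{\|x\|=1}\langle x,W_kx\rangle$. Let $\nabla^kf$ be the Gâteaux gradient in the scalar product $\langle\cdot,\cdot\rangle_k$ and, for $\gamma>0$, $\mathrm{prox}^k_{\gamma g}(z)=\operatorname{argmin}_{y}\,\gamma g(y)+\tfrac12\|y-z\|_k^2$ (its unique minimizer). Set $$J_k(x,\gamma,\lambda)=x+\lambda\big(\mathrm{prox}^k_{\gamma g}(x-\gamma\nabla^kf(x))-x\big).$$ Let $x_0\in\operatorname{dom}g$ and, for all $k\in\mathbb N$, with $\gamma_k>0$ and $\lambda_k\in\left]0,1\right]$, $$y_k=\mathrm{prox}^k_{\gamma_kg}\big(x_k-\gamma_k\nabla^kf(x_k)\big),\qquad x_{k+1}=x_k+\lambda_k(y_k-x_k),$$ where $(\gamma_k)$ and $(\lambda_k)$ are determined by one of the following rules, for some constants $\delta,\theta\in\left]0,1\right[$, $\bar\gamma>0$, $\bar\lambda\in\left]0,1\right]$: - **LS1.** $0<\inf_k\lambda_k\le\sup_k\lambda_k\le1$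 and, for every $k$, $\gamma_k$ is the largest $\gamma\in\{\bar\gamma\theta^i: i\in\mathbb N\}$ such that $f(J_k(x_k,\gamma,\lambda_k))-f(x_k)-\langle J_k(x_k,\gamma,\lambda_k)-x_k,\nabla f(x_k)\rangle\le\frac{\delta}{\gamma\lambda_k}\|J_k(x_k,\gamma,\lambda_k)-x_k\|_k^2$. - **LS2.** $0<\inf_k\gamma_k\le\sup_k\gamma_k<+\infty$ and, for every $k$, $\lambda_k$ is the largest $\lambda\in\{\bar\lambda\theta^i: i\in\mathbb N\}$ such that $f(J_k(x_k,\gamma_k,\lambda))-f(x_k)-\langle J_k(x_k,\gamma_k,\lambda)-x_k,\nabla f(x_k)\rangle\le\frac{\delta}{\gamma_k\lambda}\|J_k(x_k,\gamma_k,\lambda)-x_k\|_k^2$. - **LS3.** $0<\inf_k\gamma_k\le\sup_k\gamma_k<+\infty$ and, for every $k$, $\lambda_k$ is the largest $\lambda\in\{\bar\lambda\theta^i: i\in\mathbb N\}$ such that $(f+g)(J_k(x_k,\gamma_k,\lambda))-(f+g)(x_k)\le(1-\delta)\lambda\big(g(y_k)-g(x_k)+\langle y_k-x_k,\nabla f(x_k)\rangle\big)$.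 - **LS4.** $0<\inf_k\lambda_k\le\sup_k\lambda_k\le1$ and, for every $k$, $\gamma_k$ is the largest $\gamma\in\{\bar\gamma\theta^i: i\in\mathbb N\}$ such that $\|\nabla^kf(J_k(x_k,\gamma,\lambda_k))-\nabla^kf(x_k)\|_k\le\frac{\delta}{\gamma\lambda_k}\|J_k(x_k,\gamma,\lambda_k)-x_k\|_k$. Set $S_*=\operatorname{argmin}(f+g)$. Then: 1. $((f+g)(x_k))_k$ is decreasing (in the wide sense). 2. If $\inf_k(f+g)(x_k)>-\infty$, then $\sum_k\|x_{k+1}-x_k\|^2<+\infty$. 3. If $S_*\ne\varnothing$, then (a) $(x_k)$ and $(y_k)$ converge weakly to the same point of $S_*$; (b) $(f+g)(y_k)\to\inf_{\mathcal H}(f+g)$; (c) if $\sum_k\gamma_k\lambda_k=+\infty$, then $(f+g)(x_k)\to\inf_{\mathcal H}(f+g)$; (d) if $\inf_k\gamma_k\lambda_k>0$, then $(f+g)(x_k)-\inf_{\mathcal H}(f+g)=o(1/k)$. 4. If $S_*=\varnothing$, then $\|x_k\|\to+\infty$ and $(f+g)(x_k)\to\inf_{\mathcal H}(f+g)$ (possibly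 $-\infty$). -/

import Mathlib

open Filter Topology Asymptotics
open scoped InnerProductSpace

noncomputable section

namespace VMFBS

variable {H : Type*} [NormedAddCommGroup H] [InnerProductSpace ℝ H]

/-! ### Extended-real-valued functions -/

/-- The effective domain of `h : H → ]-∞, +∞]`. -/
def dom (h : H → EReal) : Set H := {x | h x < ⊤}

/-- `h : H → ]-∞, +∞]` is proper, convex and lower semicontinuous. -/
structure IsProperConvexLsc (h : H → EReal) : Prop where
  ne_bot : ∀ x, h x ≠ ⊥
  nonempty_dom : (dom h).Nonempty
  convex : ∀ x y : H, ∀ a b : ℝ, 0 < a → 0 < b → a + b = 1 →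
    h (a • x + b • y) ≤ (a : EReal) * h x + (b : EReal) * h y
  lsc : LowerSemicontinuous h

/-- The set of global minimizers of `h`. -/
def argmin (h : H → EReal) : Set H := {x | h x = ⨅ z, h z}

/-! ### Metrics: the scalar product with associated operator `W` is `⟪x, W y⟫` -/

/-- The scalar product with associated operator `W`. -/
def metricInner (W : H →L[ℝ] H) (x y : H) : ℝ := ⟪x, W y⟫_ℝ

/-- The squared norm in the metric with associated operator `W`. -/
def metricNormSq (W : H →L[ℝ] H) (x : H) : ℝ := metricInner W x x

/-- The norm in the metric with associated operator `W`. -/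
def metricNorm (W : H →L[ℝ] H) (x : H) : ℝ := Real.sqrt (metricNormSq W x)

/-- The maximum eigenvalue `sup_{‖x‖ = 1} ⟪x, W x⟫`. -/
def maxEigenvalue (W : H →L[ℝ] H) : ℝ :=
  sSup ((fun x : H => ⟪x, W x⟫_ℝ) '' Metric.sphere (0 : H) 1)

/-- The minimum eigenvalue `inf_{‖x‖ = 1} ⟪x, W x⟫`. -/
def minEigenvalue (W : H →L[ℝ] H) : ℝ :=
  sInf ((fun x : H => ⟪x, W x⟫_ℝ) '' Metric.sphere (0 : H) 1)

/-- `u` is the Gâteaux gradient of `h` at `x ∈ dom h` in the metric with associated operator `W`: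
for every direction `d`, `(h (x + t d) - h x) / t → ⟪d, u⟫_W` as `t → 0`, `t ≠ 0`. -/
def HasGateauxGradientAt (W : H →L[ℝ] H) (h : H → EReal) (x u : H) : Prop :=
  x ∈ dom h ∧ ∀ d : H,
    Tendsto (fun t : ℝ => (h (x + t • d) - h x) / (t : EReal)) (𝓝[≠] (0 : ℝ))
      (𝓝 ((metricInner W d u : ℝ) : EReal))

/-- The Gâteaux gradient in the metric with associated operator `W` (arbitrary if there is
none). -/
def metricGradient (W : H →L[ℝ] H) (h : H → EReal) (x : H) : H :=
  Classical.epsilon fun u => HasGateauxGradientAt W h x u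

/-- The Gâteaux gradient in the original metric of `H`. -/
def gateauxGradient (h : H → EReal) (x : H) : H :=
  metricGradient (ContinuousLinearMap.id ℝ H) h x

/-- Gâteaux differentiability on a set. -/
def GateauxDifferentiableOn (h : H → EReal) (A : Set H) : Prop :=
  ∀ x ∈ A, ∃ u, HasGateauxGradientAt (ContinuousLinearMap.id ℝ H) h x u

/-- The proximity operator of `h` in the metric with associated operator `W`: the minimizer of
`y ↦ h y + (1/2) ‖y - z‖_W²`. -/
def prox (W : H →L[ℝ] H) (h : H → EReal) (z : H) : H :=
  Classical.epsilon fun p =>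
    p ∈ argmin fun y => h y + ((1 / 2 * metricNormSq W (y - z) : ℝ) : EReal)

/-! ### Standing hypotheses -/

/-- `f` and `g` are proper, convex and lower semicontinuous, and `dom g ⊆ dom f`. -/
structure H1 (f g : H → EReal) : Prop where
  left : IsProperConvexLsc f
  right : IsProperConvexLsc g
  dom_subset : dom g ⊆ dom f

/-- `f` is Gâteaux differentiable on `dom g`, and its gradient is uniformly continuous on every
weakly compact subset of `dom g`. -/
structure H2 (f g : H → EReal) : Prop where
  differentiable : GateauxDifferentiableOn f (dom g)
  uniformContinuousOn : ∀ K : Set H, K ⊆ dom g → IsCompact (toWeakSpace ℝ H '' K) →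
    UniformContinuousOn (gateauxGradient f) K

/-- The scalar products associated with the positive operators `W k` are uniformly equivalent to
the original one. -/
def H3 (W : ℕ → H →L[ℝ] H) : Prop :=
  (∀ k, (W k).IsPositive) ∧
  ∃ ν μ : ℝ, 0 < ν ∧ ν ≤ μ ∧ ∀ k, ∀ x : H,
    ν * ‖x‖ ^ 2 ≤ metricNormSq (W k) x ∧ metricNormSq (W k) x ≤ μ * ‖x‖ ^ 2

/-- Quasi-monotonicity of the metrics. -/
def H4 (W : ℕ → H →L[ℝ] H) : Prop :=
  ∃ η : ℕ → ℝ, (∀ k, 0 ≤ η k) ∧ Summable η ∧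
    ∀ k, ∀ x : H, metricNormSq (W (k + 1)) x ≤ (1 + η k) * metricNormSq (W k) x

/-- Summability of the gaps between extreme eigenvalues. -/
def H5 (W : ℕ → H →L[ℝ] H) : Prop :=
  Summable fun k => maxEigenvalue (W k) - minEigenvalue (W k)

/-! ### The algorithm and the line searches -/

/-- `prox_{γ g} (x - γ ∇f(x))`, both operations taken in the metric with operator `W`. -/
def forwardBackward (f g : H → EReal) (W : H →L[ℝ] H) (x : H) (γ : ℝ) : H :=
  prox W (fun z => (γ : EReal) * g z) (x - γ • metricGradient W f x)

/-- The relaxed forward-backward step `J(x, γ, lam)` in the metric with operator `W`. -/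
def J (f g : H → EReal) (W : H →L[ℝ] H) (x : H) (γ lam : ℝ) : H :=
  x + lam • (forwardBackward f g W x γ - x)

/-- `x`, `y` are generated by the variable metric forward-backward algorithm with stepsizes `γ`
and relaxation parameters `lam`. -/
structure IsVMFBS (f g : H → EReal) (W : ℕ → H →L[ℝ] H) (γ lam : ℕ → ℝ) (x y : ℕ → H) :
    Prop where
  x_zero_mem : x 0 ∈ dom g
  γ_pos : ∀ k, 0 < γ k
  lam_pos : ∀ k, 0 < lam k
  lam_le_one : ∀ k, lam k ≤ 1
  y_eq : ∀ k, y k = forwardBackward f g (W k) (x k) (γ k)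
  x_succ : ∀ k, x (k + 1) = x k + lam k • (y k - x k)

/-- The backtracking grid `a, a θ, a θ², …` of positive candidates. -/
def grid (a θ : ℝ) : Set ℝ := {s | 0 < s ∧ ∃ i : ℕ, s = a * θ ^ i}

/-- The descent test at `x` for the parameters `γ`, `lam`. -/
def DescentTest (f g : H → EReal) (W : H →L[ℝ] H) (δ : ℝ) (x : H) (γ lam : ℝ) : Prop :=
  f (J f g W x γ lam) - f x - ((⟪J f g W x γ lam - x, gateauxGradient f x⟫_ℝ : ℝ) : EReal) ≤
    ((δ / (γ * lam) * metricNormSq W (J f g W x γ lam - x) : ℝ) : EReal)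

/-- The Armijo-type test at `x` for the parameters `γ`, `lam`. -/
def ArmijoTest (f g : H → EReal) (W : H →L[ℝ] H) (δ : ℝ) (x : H) (γ lam : ℝ) : Prop :=
  (f (J f g W x γ lam) + g (J f g W x γ lam)) - (f x + g x) ≤
    (((1 - δ) * lam : ℝ) : EReal) *
      (g (forwardBackward f g W x γ) - g x +
        ((⟪forwardBackward f g W x γ - x, gateauxGradient f x⟫_ℝ : ℝ) : EReal))

/-- The gradient test at `x` for the parameters `γ`, `lam`. -/
def GradientTest (f g : H → EReal) (W : H →L[ℝ] H) (δ : ℝ) (x : H) (γ lam : ℝ) : Prop :=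
  metricNorm W (metricGradient W f (J f g W x γ lam) - metricGradient W f x) ≤
    δ / (γ * lam) * metricNorm W (J f g W x γ lam - x)

/-- Search on the stepsize with the descent test. -/
def LS1 (f g : H → EReal) (W : ℕ → H →L[ℝ] H) (γ lam : ℕ → ℝ) (x : ℕ → H) : Prop :=
  (0 < ⨅ k, lam k) ∧ (∀ k, lam k ≤ 1) ∧
  ∃ δ ∈ Set.Ioo (0 : ℝ) 1, ∃ θ ∈ Set.Ioo (0 : ℝ) 1, ∃ γbar : ℝ, 0 < γbar ∧
    ∀ k, IsGreatest {s ∈ grid γbar θ | DescentTest f g (W k) δ (x k) s (lam k)} (γ k)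

/-- Search on the relaxation parameter with the descent test. -/
def LS2 (f g : H → EReal) (W : ℕ → H →L[ℝ] H) (γ lam : ℕ → ℝ) (x : ℕ → H) : Prop :=
  (0 < ⨅ k, γ k) ∧ BddAbove (Set.range γ) ∧
  ∃ δ ∈ Set.Ioo (0 : ℝ) 1, ∃ θ ∈ Set.Ioo (0 : ℝ) 1, ∃ lbar ∈ Set.Ioc (0 : ℝ) 1,
    ∀ k, IsGreatest {s ∈ grid lbar θ | DescentTest f g (W k) δ (x k) (γ k) s} (lam k)

/-- Search on the relaxation parameter with the Armijo-type test. -/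
def LS3 (f g : H → EReal) (W : ℕ → H →L[ℝ] H) (γ lam : ℕ → ℝ) (x : ℕ → H) : Prop :=
  (0 < ⨅ k, γ k) ∧ BddAbove (Set.range γ) ∧
  ∃ δ ∈ Set.Ioo (0 : ℝ) 1, ∃ θ ∈ Set.Ioo (0 : ℝ) 1, ∃ lbar ∈ Set.Ioc (0 : ℝ) 1,
    ∀ k, IsGreatest {s ∈ grid lbar θ | ArmijoTest f g (W k) δ (x k) (γ k) s} (lam k)

/-- Search on the stepsize with the gradient test. -/
def LS4 (f g : H → EReal) (W : ℕ → H →L[ℝ] H) (γ lam : ℕ → ℝ) (x : ℕ → H) : Prop :=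
  (0 < ⨅ k, lam k) ∧ (∀ k, lam k ≤ 1) ∧
  ∃ δ ∈ Set.Ioo (0 : ℝ) 1, ∃ θ ∈ Set.Ioo (0 : ℝ) 1, ∃ γbar : ℝ, 0 < γbar ∧
    ∀ k, IsGreatest {s ∈ grid γbar θ | GradientTest f g (W k) δ (x k) s (lam k)} (γ k)

/-- Weak convergence of a sequence. -/
def WeaklyConvergesTo (x : ℕ → H) (z : H) : Prop :=
  Tendsto (fun k => toWeakSpace ℝ H (x k)) atTop (𝓝 (toWeakSpace ℝ H z))

end VMFBS

end

/-! Write `F = f + g`, `y` for the forward-backward point of `x`, and `D = g x - g y + ⟪x - y, ∇f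
x⟫` for the predicted decrease. The variational inequality of the proximity operator, tested at `x`,
gives `‖x - y‖_W² ≤ γ D`, so `D ≥ 0`. The three tests are nested: gradient implies descent implies
Armijo. Hence every rule yields the decrease `(1 - δ) λ D ≤ F(x_k) - F(x_{k+1})`, and a trial
rejected by any rule also fails the gradient test, so `∇f` varies there by more than a multiple of
`‖y - x‖ / γ`. `IsSearchRun` records exactly these two consequences and lets the four rules be
treated at once.

Two estimates follow. (i) Testing the variational inequality at `z` gives `‖x_{k+1} - z‖_k² ≤ ‖x_k -
z‖_k² + e_k - 2 γ_k λ_k (F(x_k) - F(z))`. The errors `e_k` telescope when `F(z) ≤ F(x_k)` for all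
`k`. Under either metric condition this becomes quasi-Fejér monotonicity for quasi-decreasing
metrics (`fejer`). (ii) Along bounded iterates `‖y_k - x_k‖ = o(γ_k)` (`residual`): either the
parameters are bounded below and the vanishing steps suffice, or uniform continuity of `∇f` on a
bounded sublevel set of `g`, which is weakly compact, contradicts the rejection of the last trial.
Dividing the variational inequality by `γ_k` then shows that `F(y_k)` is asymptotically minimal and
that weak cluster points are minimizers.

If minimizers exist, Opial's argument gives weak convergence, and the summability of `γ_k λ_k
(F(x_k) - min F)` together with monotonicity gives the values and, by Olivier's theorem, the rate.
If none exists, a bounded subsequence would produce one, so the norms diverge. A point `z` with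
`F(z)` below all `F(x_k)` would bound the iterates by (i), so the values tend to the infimum. -/

noncomputable section
namespace VMFBS

/-! ### Weak convergence and weak compactness in a Hilbert space -/

section WeakTopology

variable {H : Type*} [NormedAddCommGroup H] [InnerProductSpace ℝ H]

theorem tendsto_toWeakSpace_iff [CompleteSpace H] {ι : Type*} {l : Filter ι} {u : ι → H} {z : H} :
    Tendsto (fun i => toWeakSpace ℝ H (u i)) l (𝓝 (toWeakSpace ℝ H z)) ↔
      ∀ w : H, Tendsto (fun i => ⟪w, u i⟫_ℝ) l (𝓝 ⟪w, z⟫_ℝ) := by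
  have hinj : Function.Injective (topDualPairing ℝ H).flip := by
    intro a b hab
    refine ext_inner_left ℝ fun w => ?_
    exact LinearMap.congr_fun hab (InnerProductSpace.toDual ℝ H w)
  refine (WeakBilin.tendsto_iff_forall_eval_tendsto (topDualPairing ℝ H).flip hinj).trans ?_
  constructor
  · intro h w
    exact h (InnerProductSpace.toDual ℝ H w)
  · intro h φ
    have := h ((InnerProductSpace.toDual ℝ H).symm φ)
    simp only [InnerProductSpace.toDual_symm_apply] at this
    exact this

/-- Mazur's theorem: the weak and norm closures of a convex set coincide. -/
theorem isClosed_toWeakSpace_image {K : Set H} (hK : Convex ℝ K) (hc : IsClosed K) :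
    IsClosed (toWeakSpace ℝ H '' K) := by
  rw [← closure_eq_iff_isClosed, ← hK.toWeakSpace_closure (𝕜 := ℝ), hc.closure_eq]

/-- Banach–Alaoglu, carried over by the Riesz isomorphism, which is continuous from the weak-* to
the weak topology by symmetry of the scalar product. -/
theorem isCompact_toWeakSpace_image [CompleteSpace H] {K : Set H} (hK : Convex ℝ K)
    (hc : IsClosed K) (hb : Bornology.IsBounded K) : IsCompact (toWeakSpace ℝ H '' K) := by
  obtain ⟨R, hR⟩ := hb.subset_closedBall 0
  let Φ : WeakDual ℝ H → WeakSpace ℝ H := fun φ =>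
    toWeakSpace ℝ H ((InnerProductSpace.toDual ℝ H).symm (WeakDual.toStrongDual φ))
  have hΦ : Continuous Φ := by
    refine WeakBilin.continuous_of_continuous_eval _ fun ψ => ?_
    have : ∀ φ : WeakDual ℝ H, ψ ((InnerProductSpace.toDual ℝ H).symm (WeakDual.toStrongDual φ))
        = φ ((InnerProductSpace.toDual ℝ H).symm ψ) := by
      intro φ
      rw [← InnerProductSpace.toDual_symm_apply (y := ψ), real_inner_comm,
        InnerProductSpace.toDual_symm_apply]
      rfl
    exact (WeakDual.eval_continuous ((InnerProductSpace.toDual ℝ H).symm ψ)).congr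
      fun φ => (this φ).symm
  have hcomp := (WeakDual.isCompact_closedBall (𝕜 := ℝ) (0 : StrongDual ℝ H) R).image hΦ
  refine hcomp.of_isClosed_subset (isClosed_toWeakSpace_image hK hc) ?_
  rintro _ ⟨x, hx, rfl⟩
  refine ⟨StrongDual.toWeakDual (InnerProductSpace.toDual ℝ H x), ?_, ?_⟩
  · have := hR hx
    simpa using this
  · simp [Φ]

theorem mem_of_tendsto_toWeakSpace {ι : Type*} {l : Filter ι} [l.NeBot] {u : ι → H} {z : H}
    {K : Set H} (hK : Convex ℝ K) (hc : IsClosed K)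
    (hu : Tendsto (fun i => toWeakSpace ℝ H (u i)) l (𝓝 (toWeakSpace ℝ H z)))
    (hmem : ∀ᶠ i in l, u i ∈ K) : z ∈ K := by
  have := (isClosed_toWeakSpace_image hK hc).mem_of_tendsto hu
    (hmem.mono fun i hi => Set.mem_image_of_mem _ hi)
  obtain ⟨w, hw, hwz⟩ := this
  rwa [(toWeakSpace ℝ H).injective hwz] at hw

/-- Ultrafilters stand in for weakly convergent subsequences, so that compactness is enough and
sequential compactness is not needed. -/
theorem exists_ultrafilter_tendsto_toWeakSpace [CompleteSpace H] {ι : Type*} {l : Filter ι}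
    [l.NeBot] {u : ι → H} {R : ℝ} (hR : ∀ᶠ i in l, ‖u i‖ ≤ R) :
    ∃ (U : Ultrafilter ι) (z : H), (U : Filter ι) ≤ l ∧
      Tendsto (fun i => toWeakSpace ℝ H (u i)) U (𝓝 (toWeakSpace ℝ H z)) := by
  have hcomp := isCompact_toWeakSpace_image (convex_closedBall (0 : H) R)
    Metric.isClosed_closedBall Metric.isBounded_closedBall
  obtain ⟨z, -, hz⟩ := hcomp.exists_mapClusterPt (u := fun i => toWeakSpace ℝ H (u i)) (f := l)
    (by
      rw [Filter.le_principal_iff, Filter.mem_map]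
      filter_upwards [hR] with i hi
      exact Set.mem_image_of_mem _ (by simpa using hi))
  obtain ⟨U, hU, hUz⟩ := mapClusterPt_iff_ultrafilter.1 hz
  exact ⟨U, (toWeakSpace ℝ H).symm z, hU, by simpa using hUz⟩

end WeakTopology

/-! ### Quasi-Fejér sequences and summable monotone sequences of reals -/

section RealSequences

theorem one_le_prod_one_add {η : ℕ → ℝ} (hη : ∀ k, 0 ≤ η k) (k : ℕ) :
    1 ≤ ∏ j ∈ Finset.range k, (1 + η j) :=
  Finset.prod_induction _ (fun t => 1 ≤ t) (fun _ _ => one_le_mul_of_one_le_of_one_le) le_rfl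
    fun j _ => by linarith [hη j]

theorem tendsto_prod_one_add {η : ℕ → ℝ} (hη : ∀ k, 0 ≤ η k) (hηs : Summable η) :
    ∃ Q, 1 ≤ Q ∧ Tendsto (fun k => ∏ j ∈ Finset.range k, (1 + η j)) atTop (𝓝 Q) ∧
      ∀ k, ∏ j ∈ Finset.range k, (1 + η j) ≤ Q := by
  have hmono : Monotone fun k => ∏ j ∈ Finset.range k, (1 + η j) := by
    refine monotone_nat_of_le_succ fun k => ?_
    simp only [Finset.prod_range_succ]
    nlinarith [hη k, one_le_prod_one_add hη k]
  have hbdd : BddAbove (Set.range fun k => ∏ j ∈ Finset.range k, (1 + η j)) := by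
    refine ⟨Real.exp (∑' j, η j), ?_⟩
    rintro _ ⟨k, rfl⟩
    calc ∏ j ∈ Finset.range k, (1 + η j) ≤ ∏ j ∈ Finset.range k, Real.exp (η j) :=
          Finset.prod_le_prod (fun j _ => by linarith [hη j])
            fun j _ => by linarith [Real.add_one_le_exp (η j)]
      _ = Real.exp (∑ j ∈ Finset.range k, η j) := (Real.exp_sum _ _).symm
      _ ≤ _ := Real.exp_le_exp.2 (hηs.sum_le_tsum _ fun j _ => hη j)
  exact ⟨_, (one_le_prod_one_add hη 0).trans (le_ciSup hbdd 0), tendsto_atTop_ciSup hmono hbdd,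
    le_ciSup hbdd⟩

/-- A deterministic Robbins–Siegmund lemma. -/
theorem quasiFejer {a b e η : ℕ → ℝ} (ha : ∀ k, 0 ≤ a k) (hb : ∀ k, 0 ≤ b k) (he : ∀ k, 0 ≤ e k)
    (hη : ∀ k, 0 ≤ η k) (hes : Summable e) (hηs : Summable η)
    (h : ∀ k, a (k + 1) ≤ (1 + η k) * a k + e k - b k) :
    (∃ L, Tendsto a atTop (𝓝 L)) ∧ Summable b := by
  obtain ⟨Q, hQ1, hQ, hPQ⟩ := tendsto_prod_one_add hη hηs
  set P : ℕ → ℝ := fun k => ∏ j ∈ Finset.range k, (1 + η j) with hP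
  have hP1 : ∀ k, 1 ≤ P k := one_le_prod_one_add hη
  have hP0 : ∀ k, 0 < P k := fun k => zero_lt_one.trans_le (hP1 k)
  have hPs : ∀ k, P (k + 1) = P k * (1 + η k) := fun k => Finset.prod_range_succ _ _
  -- Division by the partial products of `1 + η j` absorbs the growth factors; `c` below is then a
  -- decreasing sequence bounded from below.
  set B : ℕ → ℝ := fun k => b k / P (k + 1) with hB
  set E : ℕ → ℝ := fun k => e k / P (k + 1) with hE
  have hB0 : ∀ k, 0 ≤ B k := fun k => div_nonneg (hb k) (hP0 _).le
  have hE0 : ∀ k, 0 ≤ E k := fun k => div_nonneg (he k) (hP0 _).le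
  have hEs : Summable E := hes.of_nonneg_of_le hE0 fun k => div_le_self (he k) (hP1 _)
  set c : ℕ → ℝ := fun k => a k / P k + ∑ j ∈ Finset.range k, B j - ∑ j ∈ Finset.range k, E j
    with hc
  have hca : Antitone c := by
    refine antitone_nat_of_succ_le fun k => ?_
    have h1 : a (k + 1) / P (k + 1) ≤ a k / P k + E k - B k := by
      have h2 : a k / P k + E k - B k = ((1 + η k) * a k + e k - b k) / P (k + 1) := by
        have := (hP0 k).ne'
        have h3 : 1 + η k ≠ 0 := by linarith [hη k]
        simp only [hE, hB, hPs]
        field_simp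
      rw [h2]
      exact div_le_div_of_nonneg_right (h k) (hP0 _).le
    simp only [hc, Finset.sum_range_succ]
    linarith
  have haP : ∀ k, 0 ≤ a k / P k := fun k => div_nonneg (ha k) (hP0 k).le
  have hEt : ∀ k, ∑ j ∈ Finset.range k, E j ≤ ∑' j, E j :=
    fun k => hEs.sum_le_tsum _ fun j _ => hE0 j
  have hBs : Summable B := by
    refine summable_of_sum_range_le (c := c 0 + ∑' j, E j) hB0 fun k => ?_
    have h1 : c k ≤ c 0 := hca (Nat.zero_le k)
    have h2 : c k = a k / P k + ∑ j ∈ Finset.range k, B j - ∑ j ∈ Finset.range k, E j := rfl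
    linarith [haP k, hEt k]
  have hcb : BddBelow (Set.range c) := by
    refine ⟨-∑' j, E j, ?_⟩
    rintro _ ⟨k, rfl⟩
    have h2 : c k = a k / P k + ∑ j ∈ Finset.range k, B j - ∑ j ∈ Finset.range k, E j := rfl
    have h3 : 0 ≤ ∑ j ∈ Finset.range k, B j := Finset.sum_nonneg fun j _ => hB0 j
    linarith [haP k, hEt k]
  have hct := tendsto_atTop_ciInf hca hcb
  constructor
  · refine ⟨_, Tendsto.congr (fun k => ?_)
      (((hct.sub hBs.tendsto_sum_tsum_nat).add hEs.tendsto_sum_tsum_nat).mul hQ)⟩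
    have := (hP0 k).ne'
    simp only [hc]
    rw [show a k / P k + ∑ j ∈ Finset.range k, B j - ∑ j ∈ Finset.range k, E j -
      ∑ j ∈ Finset.range k, B j + ∑ j ∈ Finset.range k, E j = a k / P k by ring]
    exact div_mul_cancel₀ _ this
  · refine (hBs.mul_left Q).of_nonneg_of_le hb fun k => ?_
    have h1 : b k = P (k + 1) * B k := (mul_div_cancel₀ _ (hP0 _).ne').symm
    rw [h1]
    exact mul_le_mul_of_nonneg_right (hPQ _) (hB0 k)

/-- Olivier's theorem. -/
theorem isLittleO_of_antitone_summable {r : ℕ → ℝ} (hr : Antitone r) (hs : Summable r) :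
    r =o[atTop] fun k : ℕ => 1 / (k : ℝ) := by
  have hr0 : ∀ k, 0 ≤ r k := fun k => hr.le_of_tendsto hs.tendsto_atTop_zero k
  have hS := hs.tendsto_sum_tsum_nat
  have hhalf : Tendsto (fun n : ℕ => n / 2) atTop atTop :=
    Nat.tendsto_div_const_atTop two_ne_zero
  have hdiff : Tendsto (fun n => 2 * (∑ j ∈ Finset.range n, r j - ∑ j ∈ Finset.range (n / 2), r j))
      atTop (𝓝 0) := by
    simpa using (hS.sub (hS.comp hhalf)).const_mul 2
  have hkey : ∀ n : ℕ, n * r n ≤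
      2 * (∑ j ∈ Finset.range n, r j - ∑ j ∈ Finset.range (n / 2), r j) := by
    intro n
    rw [← Finset.sum_Ico_eq_sub _ (Nat.div_le_self n 2)]
    -- Each of the `n - n / 2 ≥ n / 2` terms between `n / 2` and `n` is at least `r n`, and their
    -- sum tends to zero.
    have h1 : ∑ j ∈ Finset.Ico (n / 2) n, r n ≤ ∑ j ∈ Finset.Ico (n / 2) n, r j :=
      Finset.sum_le_sum fun j hj => hr (Finset.mem_Ico.1 hj).2.le
    rw [Finset.sum_const, Nat.card_Ico, nsmul_eq_mul] at h1
    have h2 : (n : ℝ) ≤ 2 * ((n - n / 2 : ℕ) : ℝ) := by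
      have : n ≤ 2 * (n - n / 2) := by omega
      exact_mod_cast this
    nlinarith [hr0 n]
  have ht : Tendsto (fun n : ℕ => n * r n) atTop (𝓝 0) :=
    squeeze_zero (fun n => mul_nonneg n.cast_nonneg (hr0 n)) hkey hdiff
  refine (isLittleO_iff_tendsto' ?_).2 (ht.congr fun n => ?_)
  · filter_upwards [eventually_gt_atTop 0] with n hn h
    have : (0 : ℝ) < n := by exact_mod_cast hn
    exact absurd h (by positivity)
  · rw [div_div_eq_mul_div, div_one, mul_comm]

end RealSequences

section MetricsAndConvexFunctions

variable {H : Type*} [NormedAddCommGroup H] [InnerProductSpace ℝ H]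

/-! ### Equivalent metrics: Cauchy–Schwarz, norm comparison, surjectivity -/

section Metric

/-- The metric with associated operator `W` is equivalent to the original one, with constants
`ν` and `μ`. -/
structure IsEquivalentMetric (ν μ : ℝ) (W : H →L[ℝ] H) : Prop where
  ν_pos : 0 < ν
  symm : ∀ u v : H, ⟪W u, v⟫_ℝ = ⟪u, W v⟫_ℝ
  lower : ∀ u : H, ν * ‖u‖ ^ 2 ≤ metricNormSq W u
  upper : ∀ u : H, metricNormSq W u ≤ μ * ‖u‖ ^ 2

theorem H3.exists_isEquivalentMetric {W : ℕ → H →L[ℝ] H} (h : H3 W) :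
    ∃ ν μ : ℝ, 0 < ν ∧ ν ≤ μ ∧ ∀ k, IsEquivalentMetric ν μ (W k) := by
  obtain ⟨hpos, ν, μ, hν, hνμ, hb⟩ := h
  exact ⟨ν, μ, hν, hνμ, fun k => ⟨hν, (hpos k).inner_left_eq_inner_right, fun u => (hb k u).1,
    fun u => (hb k u).2⟩⟩

theorem metricNormSq_id (u : H) : metricNormSq (ContinuousLinearMap.id ℝ H) u = ‖u‖ ^ 2 :=
  real_inner_self_eq_norm_sq u

theorem isEquivalentMetric_id : IsEquivalentMetric 1 1 (ContinuousLinearMap.id ℝ H) where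
  ν_pos := one_pos
  symm _ _ := rfl
  lower u := by rw [metricNormSq_id, one_mul]
  upper u := by rw [metricNormSq_id, one_mul]

theorem metricNormSq_smul (W : H →L[ℝ] H) (t : ℝ) (u : H) :
    metricNormSq W (t • u) = t ^ 2 * metricNormSq W u := by
  simp only [metricNormSq, metricInner, map_smul, real_inner_smul_left, real_inner_smul_right]
  ring

theorem metricNormSq_sub_comm (W : H →L[ℝ] H) (u v : H) :
    metricNormSq W (u - v) = metricNormSq W (v - u) := by
  rw [← neg_sub v u, ← neg_one_smul ℝ, metricNormSq_smul]
  ring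

theorem continuous_metricNormSq (W : H →L[ℝ] H) : Continuous (metricNormSq W) := by
  unfold metricNormSq metricInner
  fun_prop

namespace IsEquivalentMetric

variable {ν μ : ℝ} {W : H →L[ℝ] H}

theorem comm (hW : IsEquivalentMetric ν μ W) (u v : H) : metricInner W u v = metricInner W v u := by
  rw [metricInner, metricInner, ← hW.symm, real_inner_comm]

theorem nonneg (hW : IsEquivalentMetric ν μ W) (u : H) : 0 ≤ metricNormSq W u :=
  (mul_nonneg hW.ν_pos.le (sq_nonneg _)).trans (hW.lower u)

theorem normSq_add (hW : IsEquivalentMetric ν μ W) (u v : H) :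
    metricNormSq W (u + v) = metricNormSq W u + 2 * metricInner W u v + metricNormSq W v := by
  have := hW.comm v u
  simp only [metricNormSq, metricInner, map_add, inner_add_left, inner_add_right] at *
  linarith

theorem normSq_sub (hW : IsEquivalentMetric ν μ W) (u v : H) :
    metricNormSq W (u - v) = metricNormSq W u - 2 * metricInner W u v + metricNormSq W v := by
  have := hW.comm v u
  simp only [metricNormSq, metricInner, map_sub, inner_sub_left, inner_sub_right] at *
  linarith

theorem inner_sq_le (hW : IsEquivalentMetric ν μ W) (u v : H) :
    metricInner W u v ^ 2 ≤ metricNormSq W u * metricNormSq W v := by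
  -- Nonnegativity of the form at `‖v‖_W² u - ⟪u, v⟫_W v` is Cauchy–Schwarz multiplied by `‖v‖_W²`;
  -- if that factor vanishes, the lower bound forces `v = 0`.
  have h := hW.nonneg (metricNormSq W v • u - metricInner W u v • v)
  rw [hW.normSq_sub, metricNormSq_smul, metricNormSq_smul] at h
  have h1 : metricInner W (metricNormSq W v • u) (metricInner W u v • v) =
      metricNormSq W v * metricInner W u v ^ 2 := by
    simp only [metricInner, map_smul, real_inner_smul_left, real_inner_smul_right]
    ring
  rw [h1] at h
  rcases (hW.nonneg v).eq_or_lt with h0 | h0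
  · have hv : v = 0 := by
      have h2 := hW.lower v
      rw [← h0] at h2
      have h3 : ‖v‖ ^ 2 ≤ 0 := by
        by_contra! h4
        nlinarith [mul_pos hW.ν_pos h4]
      exact norm_eq_zero.1 (pow_eq_zero_iff two_ne_zero |>.1 (le_antisymm h3 (sq_nonneg _)))
    simp [hv, metricInner, metricNormSq]
  · refine le_of_mul_le_mul_left ?_ h0
    nlinarith

theorem inner_le (hW : IsEquivalentMetric ν μ W) (u v : H) :
    metricInner W u v ≤ metricNorm W u * metricNorm W v := by
  rw [metricNorm, metricNorm, ← Real.sqrt_mul (hW.nonneg u)]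
  exact Real.le_sqrt_of_sq_le (hW.inner_sq_le u v)

theorem metricNorm_sq (hW : IsEquivalentMetric ν μ W) (u : H) :
    metricNorm W u ^ 2 = metricNormSq W u := Real.sq_sqrt (hW.nonneg u)

theorem metricNorm_smul (t : ℝ) (u : H) : metricNorm W (t • u) = |t| * metricNorm W u := by
  rw [metricNorm, metricNorm, metricNormSq_smul, Real.sqrt_mul (sq_nonneg t), Real.sqrt_sq_eq_abs]

theorem sqrt_mul_norm_le (hW : IsEquivalentMetric ν μ W) (u : H) :
    Real.sqrt ν * ‖u‖ ≤ metricNorm W u := by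
  rw [metricNorm]
  refine Real.le_sqrt_of_sq_le ?_
  rw [mul_pow, Real.sq_sqrt hW.ν_pos.le]
  exact hW.lower u

theorem metricNorm_le_sqrt_mul (hW : IsEquivalentMetric ν μ W) (hμ : 0 ≤ μ) (u : H) :
    metricNorm W u ≤ Real.sqrt μ * ‖u‖ := by
  rw [metricNorm]
  refine Real.sqrt_le_iff.2 ⟨by positivity, ?_⟩
  rw [mul_pow, Real.sq_sqrt hμ]
  exact hW.upper u

/-- The dual bound `‖u‖_W ≤ ‖W u‖ / √ν`. -/
theorem metricNorm_le_div (hW : IsEquivalentMetric ν μ W) (u : H) :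
    metricNorm W u ≤ ‖W u‖ / Real.sqrt ν := by
  have hs : 0 < Real.sqrt ν := Real.sqrt_pos.2 hW.ν_pos
  rw [le_div_iff₀ hs]
  rcases (show 0 ≤ metricNorm W u from Real.sqrt_nonneg _).eq_or_lt with h0 | h0
  · rw [← h0, zero_mul]
    exact norm_nonneg _
  · refine le_of_mul_le_mul_left ?_ h0
    have h1 : metricNormSq W u ≤ ‖u‖ * ‖W u‖ := real_inner_le_norm _ _
    have h2 := hW.sqrt_mul_norm_le u
    rw [← hW.metricNorm_sq] at h1
    nlinarith [norm_nonneg (W u)]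

/-- Lax–Milgram: the lower bound makes the bilinear form coercive. -/
theorem surjective [CompleteSpace H] (hW : IsEquivalentMetric ν μ W) : Function.Surjective W := by
  have hco : IsCoercive ((innerSL ℝ).comp W : H →L[ℝ] H →L[ℝ] ℝ) := by
    refine ⟨ν, hW.ν_pos, fun u => ?_⟩
    have := hW.lower u
    rw [metricNormSq, metricInner, ← hW.symm, sq, ← mul_assoc] at this
    exact this
  intro v
  refine ⟨hco.continuousLinearEquivOfBilin.symm v, ext_inner_right ℝ fun w => ?_⟩
  have := hco.continuousLinearEquivOfBilin_apply (hco.continuousLinearEquivOfBilin.symm v) w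
  rw [ContinuousLinearEquiv.apply_symm_apply] at this
  rw [this]
  rfl

end IsEquivalentMetric

end Metric

/-! ### Proper convex lower semicontinuous functions -/

section ExtendedFunctions

variable {h : H → EReal}

namespace IsProperConvexLsc

theorem coe_toReal (hh : IsProperConvexLsc h) {x : H} (hx : x ∈ dom h) :
    ((h x).toReal : EReal) = h x :=
  EReal.coe_toReal (ne_of_lt hx) (hh.ne_bot x)

theorem convexOn (hh : IsProperConvexLsc h) : ConvexOn ℝ (dom h) fun x => (h x).toReal := by
  have key : ∀ x ∈ dom h, ∀ y ∈ dom h, ∀ a b : ℝ, 0 < a → 0 < b → a + b = 1 →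
      h (a • x + b • y) ≤ ((a * (h x).toReal + b * (h y).toReal : ℝ) : EReal) := by
    intro x hx y hy a b ha hb hab
    have := hh.convex x y a b ha hb hab
    rwa [← hh.coe_toReal hx, ← hh.coe_toReal hy, ← EReal.coe_mul, ← EReal.coe_mul,
      ← EReal.coe_add] at this
  have hdom : Convex ℝ (dom h) := convex_iff_forall_pos.2 fun x hx y hy a b ha hb hab =>
    (key x hx y hy a b ha hb hab).trans_lt (EReal.coe_lt_top _)
  refine convexOn_iff_forall_pos.2 ⟨hdom, fun x hx y hy a b ha hb hab => ?_⟩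
  have := key x hx y hy a b ha hb hab
  rw [← hh.coe_toReal (hdom hx hy ha.le hb.le hab)] at this
  exact_mod_cast this

theorem convex_sublevel (hh : IsProperConvexLsc h) (c : ℝ) : Convex ℝ {x | h x ≤ (c : EReal)} := by
  intro x hx y hy a b ha hb hab
  have hdx : x ∈ dom h := lt_of_le_of_lt hx (EReal.coe_lt_top c)
  have hdy : y ∈ dom h := lt_of_le_of_lt hy (EReal.coe_lt_top c)
  have hd := hh.convexOn.1 hdx hdy ha hb hab
  have h1 := hh.convexOn.2 hdx hdy ha hb hab
  simp only [Set.mem_ofPred_eq] at hx hy ⊢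
  rw [← hh.coe_toReal hdx] at hx
  rw [← hh.coe_toReal hdy] at hy
  rw [← hh.coe_toReal hd]
  norm_cast at hx hy ⊢
  simp only [smul_eq_mul] at h1
  have h2 : a * c + b * c = c := by rw [← add_mul, hab, one_mul]
  linarith [mul_le_mul_of_nonneg_left hx ha, mul_le_mul_of_nonneg_left hy hb]

theorem isClosed_sublevel (hh : IsProperConvexLsc h) (c : EReal) : IsClosed {x | h x ≤ c} :=
  hh.lsc.isClosed_preimage c

/-- Lower semicontinuity at one point `x₀` bounds `h` from below on a small ball. A far point is
joined to `x₀` by a segment, and convexity propagates the bound along it with linear loss, so no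
separation theorem is needed. -/
theorem exists_minorant (hh : IsProperConvexLsc h) :
    ∃ a b : ℝ, 0 ≤ a ∧ 0 ≤ b ∧ ∀ x ∈ dom h, -(a + b * ‖x‖) ≤ (h x).toReal := by
  obtain ⟨x₀, hx₀⟩ := hh.nonempty_dom
  set c := (h x₀).toReal with hc
  have hlt : ((c - 1 : ℝ) : EReal) < h x₀ := by
    rw [← hh.coe_toReal hx₀]
    exact_mod_cast sub_one_lt c
  obtain ⟨r, hr, hball⟩ := Metric.eventually_nhds_iff.1 (hh.lsc x₀ _ hlt)
  refine ⟨|c| + 1 + 2 / r * ‖x₀‖, 2 / r, by positivity, by positivity, fun x hx => ?_⟩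
  have hcabs := neg_abs_le c
  by_cases hxr : dist x x₀ < r
  · have h1 : _ < h x := hball hxr
    rw [← hh.coe_toReal hx] at h1
    have h2 : c - 1 < (h x).toReal := by exact_mod_cast h1
    have : 0 ≤ 2 / r * ‖x₀‖ := by positivity
    have : 0 ≤ 2 / r * ‖x‖ := by positivity
    linarith
  · push Not at hxr
    rw [dist_eq_norm] at hxr
    set n := ‖x - x₀‖ with hn
    have hn0 : 0 < n := hr.trans_le hxr
    -- This `t` places the intermediate point at distance `r / 2` from `x₀`, inside the ball.
    set t := r / (2 * n) with ht
    have ht0 : 0 < t := by positivity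
    have ht1 : t ≤ 1 := by
      rw [ht, div_le_one (by positivity)]
      linarith
    have hu := hh.convexOn.1 hx₀ hx (sub_nonneg.2 ht1) ht0.le (by ring)
    have hu2 := hh.convexOn.2 hx₀ hx (sub_nonneg.2 ht1) ht0.le (by ring)
    have hdist : dist ((1 - t) • x₀ + t • x) x₀ < r := by
      rw [dist_eq_norm, show (1 - t) • x₀ + t • x - x₀ = t • (x - x₀) by module, norm_smul,
        Real.norm_of_nonneg ht0.le, ← hn, ht, show r / (2 * n) * n = r / 2 by field_simp]
      linarith
    have h1 : _ < h _ := hball hdist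
    rw [← hh.coe_toReal hu] at h1
    have h2 : c - 1 < (h ((1 - t) • x₀ + t • x)).toReal := by exact_mod_cast h1
    simp only [smul_eq_mul, ← hc] at hu2
    have h3 : -1 ≤ t * ((h x).toReal - c) := by nlinarith
    have h4 : -(2 * n / r) ≤ (h x).toReal - c := by
      have h5 : t * -(2 * n / r) = -1 := by
        rw [ht]
        field_simp
      exact le_of_mul_le_mul_left (h5 ▸ h3) ht0
    have h6 : n ≤ ‖x‖ + ‖x₀‖ := norm_sub_le _ _
    have h7 : 2 * n / r ≤ 2 / r * ‖x‖ + 2 / r * ‖x₀‖ := by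
      rw [← mul_add, mul_div_right_comm]
      exact mul_le_mul_of_nonneg_left h6 (by positivity)
    linarith

theorem add {h' : H → EReal} (hh : IsProperConvexLsc h) (hh' : IsProperConvexLsc h')
    (hne : (dom h ∩ dom h').Nonempty) : IsProperConvexLsc fun x => h x + h' x where
  ne_bot x := EReal.add_ne_bot_iff.2 ⟨hh.ne_bot x, hh'.ne_bot x⟩
  nonempty_dom := by
    obtain ⟨x, hx, hx'⟩ := hne
    exact ⟨x, EReal.add_lt_top (ne_of_lt hx) (ne_of_lt hx')⟩
  convex x y a b ha hb hab := by
    refine (add_le_add (hh.convex x y a b ha hb hab) (hh'.convex x y a b ha hb hab)).trans ?_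
    rw [EReal.left_distrib_of_nonneg_of_ne_top (by exact_mod_cast ha.le) (EReal.coe_ne_top _),
      EReal.left_distrib_of_nonneg_of_ne_top (by exact_mod_cast hb.le) (EReal.coe_ne_top _)]
    exact (add_add_add_comm _ _ _ _).le
  lsc := hh.lsc.add' hh'.lsc fun x =>
    EReal.continuousAt_add (Or.inr (hh'.ne_bot x)) (Or.inl (hh.ne_bot x))

theorem const_mul (hh : IsProperConvexLsc h) {c : ℝ} (hc : 0 < c) :
    IsProperConvexLsc fun x => (c : EReal) * h x where
  ne_bot x := by
    rcases eq_or_ne (h x) ⊤ with hx | hx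
    · rw [hx, EReal.coe_mul_top_of_pos hc]
      exact top_ne_bot
    · rw [← EReal.coe_toReal hx (hh.ne_bot x), ← EReal.coe_mul]
      exact EReal.coe_ne_bot _
  nonempty_dom := by
    obtain ⟨x, hx⟩ := hh.nonempty_dom
    refine ⟨x, ?_⟩
    rw [dom, Set.mem_ofPred_eq, ← hh.coe_toReal hx, ← EReal.coe_mul]
    exact EReal.coe_lt_top _
  convex x y a b ha hb hab := by
    refine (mul_le_mul_of_nonneg_left (hh.convex x y a b ha hb hab)
      (by exact_mod_cast hc.le)).trans ?_
    rw [EReal.left_distrib_of_nonneg_of_ne_top (by exact_mod_cast hc.le) (EReal.coe_ne_top _),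
      mul_left_comm, mul_left_comm (c : EReal)]
  lsc := by
    refine (Continuous.comp_lowerSemicontinuous (g := fun t : EReal => (c : EReal) * t)
      (continuous_iff_continuousAt.2 fun t => ?_) hh.lsc ?_)
    · have hc0 : (c : EReal) ≠ 0 := by exact_mod_cast hc.ne'
      exact (EReal.continuousAt_mul (p := ((c : EReal), t)) (Or.inl hc0) (Or.inl hc0)
        (Or.inl (EReal.coe_ne_bot c)) (Or.inl (EReal.coe_ne_top c))).comp
        (continuousAt_const.prodMk continuousAt_id)
    intro s t hst
    exact mul_le_mul_of_nonneg_left hst (by exact_mod_cast hc.le)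

/-- The direct method, in the weak topology. -/
theorem argmin_nonempty [CompleteSpace H] (hh : IsProperConvexLsc h) {x₀ : H} (hx₀ : x₀ ∈ dom h)
    (hb : Bornology.IsBounded {x | h x ≤ h x₀}) : (argmin h).Nonempty := by
  rw [← hh.coe_toReal hx₀] at hb
  have hcomp := isCompact_toWeakSpace_image (hh.convex_sublevel _) (hh.isClosed_sublevel _) hb
  have hlsc : LowerSemicontinuous fun z : WeakSpace ℝ H => h ((toWeakSpace ℝ H).symm z) := by
    refine lowerSemicontinuous_iff_isClosed_preimage.2 fun c => ?_
    have : (fun z : WeakSpace ℝ H => h ((toWeakSpace ℝ H).symm z)) ⁻¹' Set.Iic c =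
        toWeakSpace ℝ H '' {x | h x ≤ c} := by
      ext z
      constructor
      · intro hz
        exact ⟨(toWeakSpace ℝ H).symm z, hz, by simp⟩
      · rintro ⟨w, hw, rfl⟩
        simpa using hw
    rw [this]
    induction c with
    | bot =>
      have : {x | h x ≤ ⊥} = ∅ := by
        ext x
        simpa using hh.ne_bot x
      rw [this, Set.image_empty]
      exact isClosed_empty
    | top => simp [Set.image_univ_of_surjective (toWeakSpace ℝ H).surjective]
    | coe c => exact isClosed_toWeakSpace_image (hh.convex_sublevel c) (hh.isClosed_sublevel _)
  obtain ⟨_, ⟨p, hp, rfl⟩, hmin⟩ := (hlsc.lowerSemicontinuousOn _).exists_isMinOn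
    (Set.Nonempty.image _ ⟨x₀, (hh.coe_toReal hx₀).ge⟩) hcomp
  refine ⟨p, le_antisymm (le_iInf fun z => ?_) (iInf_le _ _)⟩
  by_cases hz : h z ≤ ((h x₀).toReal : EReal)
  · simpa using hmin (Set.mem_image_of_mem _ hz)
  · exact le_trans hp (not_le.1 hz).le

end IsProperConvexLsc

end ExtendedFunctions

/-! ### Gâteaux gradients in different metrics -/

section Gradient

variable {f : H → EReal} {ν μ : ℝ} {W : H →L[ℝ] H} {x : H}

theorem HasGateauxGradientAt.unique {W' : H →L[ℝ] H} {u u' : H} (h : HasGateauxGradientAt W f x u)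
    (h' : HasGateauxGradientAt W' f x u') : W u = W' u' := by
  refine ext_inner_left ℝ fun d => ?_
  have := tendsto_nhds_unique (h.2 d) (h'.2 d)
  exact_mod_cast this

theorem gateauxGradient_spec {A : Set H} (hf : GateauxDifferentiableOn f A) (hx : x ∈ A) :
    HasGateauxGradientAt (ContinuousLinearMap.id ℝ H) f x (gateauxGradient f x) :=
  Classical.epsilon_spec (hf x hx)

/-- The directional derivatives do not depend on the metric, so `W` maps the metric gradient to the
ordinary one. Surjectivity of `W` supplies existence, without which the epsilon choice would be
arbitrary. -/
theorem apply_metricGradient [CompleteSpace H] (hW : IsEquivalentMetric ν μ W) {A : Set H}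
    (hf : GateauxDifferentiableOn f A) (hx : x ∈ A) :
    W (metricGradient W f x) = gateauxGradient f x := by
  have hg := gateauxGradient_spec hf hx
  obtain ⟨u, hu⟩ := hW.surjective (gateauxGradient f x)
  have hu' : HasGateauxGradientAt W f x u := by
    refine ⟨hg.1, fun d => ?_⟩
    have := hg.2 d
    rwa [metricInner, ContinuousLinearMap.id_apply, ← hu] at this
  exact (Classical.epsilon_spec (p := fun u => HasGateauxGradientAt W f x u) ⟨u, hu'⟩).unique hg

/-- By convexity, the difference quotients from `x` towards `z` with `0 < t < 1` are at most `f z -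
f x`. -/
theorem IsProperConvexLsc.gradient_ineq (hf : IsProperConvexLsc f) {u z : H}
    (hu : HasGateauxGradientAt (ContinuousLinearMap.id ℝ H) f x u) (hz : z ∈ dom f) :
    (f x).toReal + ⟪z - x, u⟫_ℝ ≤ (f z).toReal := by
  have hx := hu.1
  have hlim := (hu.2 (z - x)).mono_left (nhdsWithin_mono (0 : ℝ) (s := Set.Ioi 0) (t := {0}ᶜ)
    fun t ht => ne_of_gt ht)
  have hev : ∀ᶠ t : ℝ in 𝓝[>] (0 : ℝ), (f (x + t • (z - x)) - f x) / (t : EReal) ≤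
      (((f z).toReal - (f x).toReal : ℝ) : EReal) := by
    filter_upwards [Ioo_mem_nhdsGT (zero_lt_one (α := ℝ))] with t ht
    have hpt : x + t • (z - x) = (1 - t) • x + t • z := by module
    have hd := hf.convexOn.1 hx hz (sub_nonneg.2 ht.2.le) ht.1.le (by ring)
    have hc := hf.convexOn.2 hx hz (sub_nonneg.2 ht.2.le) ht.1.le (by ring)
    rw [hpt, ← hf.coe_toReal hd, ← hf.coe_toReal hx, ← EReal.coe_sub, ← EReal.coe_div,
      EReal.coe_le_coe_iff, div_le_iff₀ ht.1]
    simp only [smul_eq_mul] at hc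
    simp only [EReal.toReal_coe]
    linarith
  have h1 := le_of_tendsto hlim hev
  rw [EReal.coe_le_coe_iff, metricInner, ContinuousLinearMap.id_apply] at h1
  linarith

end Gradient

end MetricsAndConvexFunctions

/-! ### Proximity operators and forward-backward steps -/

section ProximalSteps

theorem le_of_sq_le_linear {α β c n : ℝ} (hα : 0 < α) (hβ : 0 ≤ β) (hc : 0 ≤ c)
    (h : α * n ^ 2 ≤ β * n + c) : n ≤ 1 + (β + c) / α := by
  rcases le_total n 1 with h1 | h1
  · linarith [div_nonneg (add_nonneg hβ hc) hα.le]
  · have h2 : n ≤ (β + c) / α := by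
      rw [le_div_iff₀ hα]
      refine le_of_mul_le_mul_right ?_ (zero_lt_one.trans_le h1)
      nlinarith
    linarith

theorem nonneg_of_forall_Ioo {A B : ℝ} (h : ∀ t ∈ Set.Ioo (0 : ℝ) 1, 0 ≤ A + t * B) : 0 ≤ A := by
  have hc : Tendsto (fun t : ℝ => A + t * B) (𝓝[>] 0) (𝓝 (A + 0 * B)) := by
    refine tendsto_nhdsWithin_of_tendsto_nhds (Continuous.tendsto ?_ 0)
    fun_prop
  rw [zero_mul, add_zero] at hc
  refine ge_of_tendsto hc ?_
  filter_upwards [Ioo_mem_nhdsGT (zero_lt_one (α := ℝ))] with t ht using h t ht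

variable {H : Type*} [NormedAddCommGroup H] [InnerProductSpace ℝ H]

section Prox

variable {g : H → EReal} {ν μ : ℝ} {W : H →L[ℝ] H}

theorem IsEquivalentMetric.isProperConvexLsc (hW : IsEquivalentMetric ν μ W) (z : H) :
    IsProperConvexLsc fun y => ((1 / 2 * metricNormSq W (y - z) : ℝ) : EReal) where
  ne_bot _ := EReal.coe_ne_bot _
  nonempty_dom := ⟨z, EReal.coe_lt_top _⟩
  convex x y a b ha hb hab := by
    rw [← EReal.coe_mul, ← EReal.coe_mul, ← EReal.coe_add, EReal.coe_le_coe_iff]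
    have h1 : a • x + b • y - z = (x - z) - b • (x - y) := by
      rw [← eq_sub_iff_add_eq] at hab
      rw [hab]
      module
    have h2 : y - z = (x - z) - (x - y) := by abel
    have h3 : metricInner W (x - z) (b • (x - y)) = b * metricInner W (x - z) (x - y) := by
      simp only [metricInner, map_smul, real_inner_smul_right]
    rw [h1, h2, hW.normSq_sub, hW.normSq_sub (x - z) (x - y), metricNormSq_smul, h3]
    have h4 := hW.nonneg (x - y)
    have h5 : a = 1 - b := by linarith
    subst h5
    nlinarith [mul_nonneg (mul_nonneg ha.le hb.le) h4]
  lsc := by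
    refine (continuous_coe_real_ereal.comp ?_).lowerSemicontinuous
    exact continuous_const.mul
      ((continuous_metricNormSq W).comp (continuous_id.sub continuous_const))

/-- The quadratic term dominates the minorant of `g`, which has linear growth in the norm; a
sublevel set is therefore bounded and the direct method applies. -/
theorem prox_spec [CompleteSpace H] (hg : IsProperConvexLsc g) (hW : IsEquivalentMetric ν μ W)
    {γ : ℝ} (hγ : 0 < γ) (z : H) :
    prox W (fun u => (γ : EReal) * g u) z ∈ argmin fun y =>
      (γ : EReal) * g y + ((1 / 2 * metricNormSq W (y - z) : ℝ) : EReal) := by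
  obtain ⟨x₀, hx₀⟩ := hg.nonempty_dom
  have hval : ∀ y ∈ dom g, (γ : EReal) * g y + ((1 / 2 * metricNormSq W (y - z) : ℝ) : EReal) =
      ((γ * (g y).toReal + 1 / 2 * metricNormSq W (y - z) : ℝ) : EReal) := by
    intro y hy
    rw [← hg.coe_toReal hy, ← EReal.coe_mul, ← EReal.coe_add, EReal.toReal_coe]
  have hd : x₀ ∈ dom fun y => (γ : EReal) * g y +
      ((1 / 2 * metricNormSq W (y - z) : ℝ) : EReal) := by
    rw [dom, Set.mem_ofPred_eq, hval x₀ hx₀]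
    exact EReal.coe_lt_top _
  have hd' : x₀ ∈ dom fun y => (γ : EReal) * g y := by
    rw [dom, Set.mem_ofPred_eq, ← hg.coe_toReal hx₀, ← EReal.coe_mul]
    exact EReal.coe_lt_top _
  have hψ := (hg.const_mul hγ).add (hW.isProperConvexLsc z) ⟨x₀, hd', EReal.coe_lt_top _⟩
  refine Classical.epsilon_spec (hψ.argmin_nonempty hd ?_)
  obtain ⟨a, b, ha, hb, hab⟩ := hg.exists_minorant
  set c := γ * (g x₀).toReal + 1 / 2 * metricNormSq W (x₀ - z) with hc
  rw [hval x₀ hx₀]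
  refine (Metric.isBounded_closedBall (x := z)
    (r := 1 + (γ * b + (|c| + γ * (a + b * ‖z‖))) / (ν / 2))).subset fun y hy => ?_
  have hyd : y ∈ dom g := by
    by_contra hcon
    rw [dom, Set.mem_ofPred_eq, not_lt_top_iff] at hcon
    rw [Set.mem_ofPred_eq, hcon, EReal.coe_mul_top_of_pos hγ, EReal.top_add_coe, top_le_iff] at hy
    exact EReal.coe_ne_top _ hy
  rw [Set.mem_ofPred_eq, hval y hyd, EReal.coe_le_coe_iff] at hy
  rw [Metric.mem_closedBall, dist_eq_norm]
  have h1 := hab y hyd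
  have h2 := hW.lower (y - z)
  have h3 : ‖y‖ ≤ ‖y - z‖ + ‖z‖ := by simpa using norm_add_le (y - z) z
  refine le_of_sq_le_linear (half_pos hW.ν_pos) (by positivity) (by positivity) ?_
  have h4 : -(γ * (a + b * (‖y - z‖ + ‖z‖))) ≤ γ * (g y).toReal := by
    have : -(a + b * (‖y - z‖ + ‖z‖)) ≤ (g y).toReal := by
      nlinarith [mul_le_mul_of_nonneg_left h3 hb]
    nlinarith [mul_le_mul_of_nonneg_left this hγ.le]
  nlinarith [le_abs_self c]

theorem prox_mem_dom [CompleteSpace H] (hg : IsProperConvexLsc g) (hW : IsEquivalentMetric ν μ W)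
    {γ : ℝ} (hγ : 0 < γ) (z : H) : prox W (fun u => (γ : EReal) * g u) z ∈ dom g := by
  obtain ⟨x₀, hx₀⟩ := hg.nonempty_dom
  by_contra hcon
  rw [dom, Set.mem_ofPred_eq, not_lt_top_iff] at hcon
  have h1 : _ = _ := prox_spec hg hW hγ z
  have h2 := h1.le.trans (iInf_le _ x₀)
  beta_reduce at h2
  rw [hcon, EReal.coe_mul_top_of_pos hγ, EReal.top_add_coe, top_le_iff, ← hg.coe_toReal hx₀,
    ← EReal.coe_mul, ← EReal.coe_add] at h2
  exact EReal.coe_ne_top _ h2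

/-- Comparing the values at `p` and at `p + t (w - p)`, dividing by `t` and letting `t → 0` leaves
the first-order condition. -/
theorem prox_variational [CompleteSpace H] (hg : IsProperConvexLsc g)
    (hW : IsEquivalentMetric ν μ W) {γ : ℝ} (hγ : 0 < γ) (z : H) {p : H}
    (hp : p = prox W (fun u => (γ : EReal) * g u) z) {w : H} (hw : w ∈ dom g) :
    γ * (g p).toReal + metricInner W (w - p) (z - p) ≤ γ * (g w).toReal := by
  have hpd : p ∈ dom g := hp ▸ prox_mem_dom hg hW hγ z
  have hspec : _ = _ := prox_spec hg hW hγ z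
  rw [← hp] at hspec
  have key : ∀ t ∈ Set.Ioo (0 : ℝ) 1, 0 ≤ (γ * (g w).toReal - γ * (g p).toReal -
      metricInner W (w - p) (z - p)) + t * (1 / 2 * metricNormSq W (w - p)) := by
    intro t ht
    have h1 := hspec.le.trans (iInf_le _ (p + t • (w - p)))
    beta_reduce at h1
    have hpt : p + t • (w - p) = (1 - t) • p + t • w := by module
    have hd := hg.convexOn.1 hpd hw (sub_nonneg.2 ht.2.le) ht.1.le (by ring)
    have hc := hg.convexOn.2 hpd hw (sub_nonneg.2 ht.2.le) ht.1.le (by ring)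
    rw [← hpt] at hd hc
    simp only [smul_eq_mul] at hc
    rw [← hg.coe_toReal hpd, ← hg.coe_toReal hd, ← EReal.coe_mul, ← EReal.coe_mul, ← EReal.coe_add,
      ← EReal.coe_add, EReal.coe_le_coe_iff,
      show p + t • (w - p) - z = t • (w - p) - (z - p) by module,
      hW.normSq_sub (t • (w - p)), metricNormSq_smul,
      metricNormSq_sub_comm W p z, show metricInner W (t • (w - p)) (z - p) =
        t * metricInner W (w - p) (z - p) from real_inner_smul_left _ _ _] at h1
    have hc' := mul_le_mul_of_nonneg_left hc hγ.le
    refine nonneg_of_mul_nonneg_right (a := t) ?_ ht.1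
    nlinarith
  have := nonneg_of_forall_Ioo key
  linarith

end Prox

/-! ### The forward-backward point, the three tests and one-step estimates -/

section ForwardBackward

variable {f g : H → EReal} {ν μ : ℝ} {W : H →L[ℝ] H} {x : H} {γ : ℝ}

theorem J_eq (lam : ℝ) : J f g W x γ lam =
    (1 - lam) • x + lam • forwardBackward f g W x γ := by
  rw [J]
  module

theorem J_sub (lam : ℝ) : J f g W x γ lam - x = lam • (forwardBackward f g W x γ - x) := by
  rw [J, add_sub_cancel_left]

variable [CompleteSpace H]

theorem forwardBackward_mem_dom (h1 : H1 f g) (hW : IsEquivalentMetric ν μ W) (hγ : 0 < γ) :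
    forwardBackward f g W x γ ∈ dom g :=
  prox_mem_dom h1.right hW hγ _

theorem forwardBackward_variational (h1 : H1 f g) (h2 : H2 f g) (hW : IsEquivalentMetric ν μ W)
    (hγ : 0 < γ) (hx : x ∈ dom g) {y z : H} (hy : y = forwardBackward f g W x γ)
    (hz : z ∈ dom g) :
    γ * (g y).toReal + metricInner W (z - y) (x - y) - γ * ⟪z - y, gateauxGradient f x⟫_ℝ ≤
      γ * (g z).toReal := by
  have h := prox_variational h1.right hW hγ _ hy hz
  have hgr := apply_metricGradient hW h2.differentiable hx
  have : metricInner W (z - y) (x - γ • metricGradient W f x - y) =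
      metricInner W (z - y) (x - y) - γ * ⟪z - y, gateauxGradient f x⟫_ℝ := by
    rw [sub_right_comm, metricInner, map_sub, map_smul, hgr, inner_sub_right,
      real_inner_smul_right]
    rfl
  rw [this] at h
  linarith

/-- The predicted decrease `g(x) - g(y) + ⟪x - y, ∇f(x)⟫`, with `y` the forward-backward point. -/
def decrement (f g : H → EReal) (W : H →L[ℝ] H) (x : H) (γ : ℝ) : ℝ :=
  (g x).toReal - (g (forwardBackward f g W x γ)).toReal +
    ⟪x - forwardBackward f g W x γ, gateauxGradient f x⟫_ℝ

/-- The variational inequality tested at `z = x`. -/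
theorem metricNormSq_le_decrement (h1 : H1 f g) (h2 : H2 f g) (hW : IsEquivalentMetric ν μ W)
    (hγ : 0 < γ) (hx : x ∈ dom g) :
    metricNormSq W (x - forwardBackward f g W x γ) ≤ γ * decrement f g W x γ := by
  have h := forwardBackward_variational h1 h2 hW hγ hx rfl hx
  have h3 : metricInner W (x - forwardBackward f g W x γ) (x - forwardBackward f g W x γ) =
    metricNormSq W (x - forwardBackward f g W x γ) := rfl
  rw [decrement]
  linarith

theorem decrement_nonneg (h1 : H1 f g) (h2 : H2 f g) (hW : IsEquivalentMetric ν μ W)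
    (hγ : 0 < γ) (hx : x ∈ dom g) : 0 ≤ decrement f g W x γ :=
  nonneg_of_mul_nonneg_right ((hW.nonneg _).trans (metricNormSq_le_decrement h1 h2 hW hγ hx)) hγ

/-- Serves to compare the accepted point with the rejected trial at the larger stepsize. Each of the
two points is tested in the variational inequality of the other, and eliminating `g` and `∇f` gives
`γ' (A - I) ≤ γ (I - A')`. If `A' < A`, this makes `‖y - y'‖_W²` vanish, a contradiction. -/
theorem metricNormSq_forwardBackward_mono (h1 : H1 f g) (h2 : H2 f g)
    (hW : IsEquivalentMetric ν μ W) {γ' : ℝ} (hγ : 0 < γ) (hγγ' : γ ≤ γ') (hx : x ∈ dom g) :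
    metricNormSq W (x - forwardBackward f g W x γ) ≤
      metricNormSq W (x - forwardBackward f g W x γ') := by
  have hγ' := hγ.trans_le hγγ'
  set y := forwardBackward f g W x γ with hy
  set y' := forwardBackward f g W x γ' with hy'
  have e1 := forwardBackward_variational h1 h2 hW hγ hx hy
    (forwardBackward_mem_dom (x := x) h1 hW hγ')
  have e2 := forwardBackward_variational h1 h2 hW hγ' hx hy'
    (forwardBackward_mem_dom (x := x) h1 hW hγ)
  rw [← hy'] at e1
  rw [← hy] at e2
  have i1 : metricInner W (y' - y) (x - y) =
      metricNormSq W (x - y) - metricInner W (x - y') (x - y) := by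
    simp only [metricInner, metricNormSq, ← inner_sub_left]
    congr 1
    abel
  have i2 : metricInner W (y - y') (x - y') =
      metricNormSq W (x - y') - metricInner W (x - y') (x - y) := by
    rw [hW.comm (x - y') (x - y)]
    simp only [metricInner, metricNormSq, ← inner_sub_left]
    congr 1
    abel
  have i3 : ⟪y - y', gateauxGradient f x⟫_ℝ = -⟪y' - y, gateauxGradient f x⟫_ℝ := by
    rw [← inner_neg_left, neg_sub]
  rw [i1] at e1
  rw [i2, i3] at e2
  have hsq := hW.nonneg (x - y' - (x - y))
  rw [hW.normSq_sub] at hsq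
  by_contra! hlt
  set A := metricNormSq W (x - y)
  set A' := metricNormSq W (x - y')
  set I := metricInner W (x - y') (x - y)
  have hpos : 0 < A - I := by linarith
  have h3 : γ' * (A - I) ≤ γ * (I - A') := by nlinarith
  have h4 : γ * (A - I) ≤ γ' * (A - I) := mul_le_mul_of_nonneg_right hγγ' hpos.le
  have h5 : A - I ≤ I - A' := le_of_mul_le_mul_left (h4.trans h3) hγ
  have h6 : I - A' < A - I := by
    by_contra! h7
    have hz : metricNormSq W (x - y' - (x - y)) = 0 := by
      rw [hW.normSq_sub]
      refine le_antisymm ?_ (by linarith)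
      linarith
    have hl := hW.lower (x - y' - (x - y))
    rw [hz] at hl
    have hn : x - y' - (x - y) = 0 := by
      by_contra hne
      have := mul_pos hW.ν_pos (pow_pos (norm_pos_iff.2 hne) 2)
      linarith
    have : x - y' = x - y := sub_eq_zero.1 hn
    rw [show A' = A from congrArg (metricNormSq W) this] at hlt
    exact lt_irrefl _ hlt
  linarith

theorem J_mem_dom (h1 : H1 f g) (hW : IsEquivalentMetric ν μ W) (hγ : 0 < γ) (hx : x ∈ dom g)
    {lam : ℝ} (hl0 : 0 ≤ lam) (hl1 : lam ≤ 1) : J f g W x γ lam ∈ dom g := by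
  rw [J_eq]
  exact h1.right.convexOn.1 hx (forwardBackward_mem_dom h1 hW hγ) (sub_nonneg.2 hl1) hl0 (by ring)

theorem toReal_J_le (h1 : H1 f g) (hW : IsEquivalentMetric ν μ W) (hγ : 0 < γ) (hx : x ∈ dom g)
    {lam : ℝ} (hl0 : 0 ≤ lam) (hl1 : lam ≤ 1) : (g (J f g W x γ lam)).toReal ≤
      (g x).toReal + lam * ((g (forwardBackward f g W x γ)).toReal - (g x).toReal) := by
  rw [J_eq]
  have := h1.right.convexOn.2 hx (forwardBackward_mem_dom (x := x) h1 hW hγ) (sub_nonneg.2 hl1) hl0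
    (by ring)
  simp only [smul_eq_mul] at this
  linarith

theorem descentTest_iff (h1 : H1 f g) (hW : IsEquivalentMetric ν μ W) (hγ : 0 < γ)
    (hx : x ∈ dom g) {lam δ : ℝ} (hl0 : 0 < lam) (hl1 : lam ≤ 1) : DescentTest f g W δ x γ lam ↔
      (f (J f g W x γ lam)).toReal - (f x).toReal -
        ⟪J f g W x γ lam - x, gateauxGradient f x⟫_ℝ ≤
      δ * lam / γ * metricNormSq W (x - forwardBackward f g W x γ) := by
  have hJ := h1.dom_subset (J_mem_dom h1 hW hγ hx hl0.le hl1)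
  rw [DescentTest, ← h1.left.coe_toReal hJ, ← h1.left.coe_toReal (h1.dom_subset hx),
    ← EReal.coe_sub, ← EReal.coe_sub, EReal.coe_le_coe_iff, EReal.toReal_coe, EReal.toReal_coe]
  rw [J_sub, metricNormSq_smul, metricNormSq_sub_comm W x,
    show δ / (γ * lam) * (lam ^ 2 * metricNormSq W (forwardBackward f g W x γ - x)) =
      δ * lam / γ * metricNormSq W (forwardBackward f g W x γ - x) by field_simp]

theorem armijoTest_iff (h1 : H1 f g) (hW : IsEquivalentMetric ν μ W) (hγ : 0 < γ)
    (hx : x ∈ dom g) {lam δ : ℝ} (hl0 : 0 < lam) (hl1 : lam ≤ 1) : ArmijoTest f g W δ x γ lam ↔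
      (1 - δ) * lam * decrement f g W x γ ≤ (f x).toReal + (g x).toReal -
        ((f (J f g W x γ lam)).toReal + (g (J f g W x γ lam)).toReal) := by
  have hJ := J_mem_dom h1 hW hγ hx hl0.le hl1
  have hy := forwardBackward_mem_dom (x := x) h1 hW hγ
  have hin : ⟪forwardBackward f g W x γ - x, gateauxGradient f x⟫_ℝ =
      -⟪x - forwardBackward f g W x γ, gateauxGradient f x⟫_ℝ := by
    rw [← inner_neg_left, neg_sub]
  rw [ArmijoTest, ← h1.left.coe_toReal (h1.dom_subset hJ), ← h1.left.coe_toReal (h1.dom_subset hx),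
    ← h1.right.coe_toReal hJ, ← h1.right.coe_toReal hx, ← h1.right.coe_toReal hy]
  norm_cast
  rw [hin, decrement]
  constructor <;> intro h <;> simp only [EReal.toReal_coe] at * <;> nlinarith

/-- Convexity of `g` on the segment from `x` to `y` is added to the descent inequality, whose
quadratic right-hand side is at most `δ λ D`. -/
theorem DescentTest.armijoTest (h1 : H1 f g) (h2 : H2 f g) (hW : IsEquivalentMetric ν μ W)
    (hγ : 0 < γ) (hx : x ∈ dom g) {lam δ : ℝ} (hδ : 0 ≤ δ) (hl0 : 0 < lam) (hl1 : lam ≤ 1)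
    (h : DescentTest f g W δ x γ lam) : ArmijoTest f g W δ x γ lam := by
  rw [descentTest_iff h1 hW hγ hx hl0 hl1] at h
  rw [armijoTest_iff h1 hW hγ hx hl0 hl1]
  have h3 := toReal_J_le h1 hW hγ hx hl0.le hl1
  have h4 := metricNormSq_le_decrement h1 h2 hW hγ hx
  have h5 : δ * lam / γ * metricNormSq W (x - forwardBackward f g W x γ) ≤
      δ * lam * decrement f g W x γ := by
    calc _ ≤ δ * lam / γ * (γ * decrement f g W x γ) :=
          mul_le_mul_of_nonneg_left h4 (by positivity)
      _ = _ := by field_simp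
  have hin : ⟪J f g W x γ lam - x, gateauxGradient f x⟫_ℝ =
      -(lam * ⟪x - forwardBackward f g W x γ, gateauxGradient f x⟫_ℝ) := by
    rw [J_sub, real_inner_smul_left, ← neg_sub x, inner_neg_left]
    ring
  rw [hin] at h
  have h6 : lam * decrement f g W x γ = lam * (g x).toReal -
      lam * (g (forwardBackward f g W x γ)).toReal +
      lam * ⟪x - forwardBackward f g W x γ, gateauxGradient f x⟫_ℝ := by
    rw [decrement]
    ring
  nlinarith

/-- The gradient inequality at the new point bounds the linearization error by `⟪J - x, ∇f(J) -
∇f(x)⟫`; Cauchy–Schwarz in the metric does the rest. -/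
theorem GradientTest.descentTest (h1 : H1 f g) (h2 : H2 f g) (hW : IsEquivalentMetric ν μ W)
    (hγ : 0 < γ) (hx : x ∈ dom g) {lam δ : ℝ} (hl0 : 0 < lam) (hl1 : lam ≤ 1)
    (h : GradientTest f g W δ x γ lam) : DescentTest f g W δ x γ lam := by
  have hJ := J_mem_dom h1 hW hγ hx hl0.le hl1
  rw [DescentTest, ← h1.left.coe_toReal (h1.dom_subset hJ), ← h1.left.coe_toReal (h1.dom_subset hx),
    ← EReal.coe_sub, ← EReal.coe_sub, EReal.coe_le_coe_iff]
  rw [GradientTest] at h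
  have h3 := h1.left.gradient_ineq (gateauxGradient_spec h2.differentiable hJ) (h1.dom_subset hx)
  have h4 := hW.inner_le (J f g W x γ lam - x)
    (metricGradient W f (J f g W x γ lam) - metricGradient W f x)
  rw [metricInner, map_sub, apply_metricGradient hW h2.differentiable hJ,
    apply_metricGradient hW h2.differentiable hx, inner_sub_right] at h4
  have h5 : ⟪x - J f g W x γ lam, gateauxGradient f (J f g W x γ lam)⟫_ℝ =
      -⟪J f g W x γ lam - x, gateauxGradient f (J f g W x γ lam)⟫_ℝ := by
    rw [← inner_neg_left, neg_sub]
  have h6 := mul_le_mul_of_nonneg_left h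
    (show 0 ≤ metricNorm W (J f g W x γ lam - x) from Real.sqrt_nonneg _)
  have h7 := hW.metricNorm_sq (J f g W x γ lam - x)
  have h8 : metricNorm W (J f g W x γ lam - x) *
      (δ / (γ * lam) * metricNorm W (J f g W x γ lam - x)) =
      δ / (γ * lam) * metricNormSq W (J f g W x γ lam - x) := by
    rw [← h7]
    ring
  linarith

/-- Used in contrapositive form: a rejected trial forces a variation of the ordinary gradient, with
constants uniform in `W`. -/
theorem gradientTest_of_norm_le (h1 : H1 f g) (h2 : H2 f g) (hW : IsEquivalentMetric ν μ W)
    (hγ : 0 < γ) (hx : x ∈ dom g) {lam δ : ℝ} (hδ : 0 ≤ δ) (hl0 : 0 < lam) (hl1 : lam ≤ 1)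
    (h : ‖gateauxGradient f (J f g W x γ lam) - gateauxGradient f x‖ ≤
      δ * ν / γ * ‖forwardBackward f g W x γ - x‖) : GradientTest f g W δ x γ lam := by
  have hJ := J_mem_dom h1 hW hγ hx hl0.le hl1
  have hs : 0 < Real.sqrt ν := Real.sqrt_pos.2 hW.ν_pos
  have h3 := hW.metricNorm_le_div (metricGradient W f (J f g W x γ lam) - metricGradient W f x)
  rw [map_sub, apply_metricGradient hW h2.differentiable hJ,
    apply_metricGradient hW h2.differentiable hx] at h3
  rw [GradientTest, J_sub, IsEquivalentMetric.metricNorm_smul, abs_of_pos hl0]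
  calc _ ≤ δ * ν / γ * ‖forwardBackward f g W x γ - x‖ / Real.sqrt ν :=
        h3.trans (div_le_div_of_nonneg_right h hs.le)
    _ = δ / γ * (Real.sqrt ν * ‖forwardBackward f g W x γ - x‖) := by
        have : ν = Real.sqrt ν * Real.sqrt ν := (Real.mul_self_sqrt hW.ν_pos.le).symm
        field_simp
        rw [this]
        simp only [Real.sqrt_mul_self hs.le]
        ring
    _ ≤ δ / γ * metricNorm W (forwardBackward f g W x γ - x) :=
        mul_le_mul_of_nonneg_left (hW.sqrt_mul_norm_le _) (by positivity)
    _ = _ := by field_simp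

/-- The quasi-Fejér inequality for one step. -/
theorem ArmijoTest.fejer (h1 : H1 f g) (h2 : H2 f g) (hW : IsEquivalentMetric ν μ W)
    (hγ : 0 < γ) (hx : x ∈ dom g) {lam δ : ℝ} (hδ : δ < 1) (hl0 : 0 < lam) (hl1 : lam ≤ 1)
    (h : ArmijoTest f g W δ x γ lam) {z : H} (hz : z ∈ dom g) :
    metricNormSq W (J f g W x γ lam - z) ≤ metricNormSq W (x - z) +
      2 * γ / (1 - δ) * ((f x).toReal + (g x).toReal -
        ((f (J f g W x γ lam)).toReal + (g (J f g W x γ lam)).toReal)) -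
      2 * (γ * lam * ((f x).toReal + (g x).toReal - ((f z).toReal + (g z).toReal))) := by
  rw [armijoTest_iff h1 hW hγ hx hl0 hl1] at h
  have h3 := forwardBackward_variational h1 h2 hW hγ hx rfl hz
  have h4 := h1.left.gradient_ineq (gateauxGradient_spec h2.differentiable hx) (h1.dom_subset hz)
  set y := forwardBackward f g W x γ with hy
  have hJ : J f g W x γ lam - z = lam • (y - x) + (x - z) := by
    rw [J]
    abel
  have h5 : metricNormSq W (J f g W x γ lam - z) = lam ^ 2 * metricNormSq W (x - y) +
      2 * (lam * metricInner W (y - x) (x - z)) + metricNormSq W (x - z) := by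
    rw [hJ, hW.normSq_add, metricNormSq_smul, metricNormSq_sub_comm W y x,
      show metricInner W (lam • (y - x)) (x - z) = lam * metricInner W (y - x) (x - z) from
        real_inner_smul_left _ _ _]
  have h6 : metricInner W (y - x) (x - z) = metricInner W (z - y) (x - y) -
      metricNormSq W (x - y) := by
    rw [hW.comm (z - y), metricNormSq, metricInner, metricInner, metricInner, ← inner_sub_right,
      ← map_sub, ← neg_sub x y, inner_neg_left, ← inner_neg_right, ← map_neg]
    congr 2
    abel
  have h7 : ⟪z - y, gateauxGradient f x⟫_ℝ =
      ⟪z - x, gateauxGradient f x⟫_ℝ + ⟪x - y, gateauxGradient f x⟫_ℝ := by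
    rw [← inner_add_left, sub_add_sub_cancel]
  have h8 : decrement f g W x γ = (g x).toReal - (g y).toReal + ⟪x - y, gateauxGradient f x⟫_ℝ :=
    rfl
  set D := decrement f g W x γ
  set N := metricNormSq W (x - y)
  have hN : 0 ≤ N := hW.nonneg _
  set Fx := (f x).toReal + (g x).toReal with hFx
  set FJ := (f (J f g W x γ lam)).toReal + (g (J f g W x γ lam)).toReal
  set Fz := (f z).toReal + (g z).toReal with hFz
  -- Variational inequality at `z`, with `f` linearized at `x` by the gradient inequality. The
  -- excess `γ D` is paid for by the Armijo decrease in `h10`.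
  have h9 : metricInner W (z - y) (x - y) ≤ γ * (Fz - Fx + D) := by
    have : γ * (Fz - Fx + D) ≥ γ * ((g z).toReal - (g y).toReal + ⟪z - y, gateauxGradient f x⟫_ℝ) :=
      mul_le_mul_of_nonneg_left (by linarith) hγ.le
    linarith
  have h10 : 2 * γ * (lam * D) ≤ 2 * γ / (1 - δ) * (Fx - FJ) := by
    rw [div_mul_eq_mul_div, le_div_iff₀ (by linarith)]
    nlinarith
  have h11 : lam * metricInner W (z - y) (x - y) ≤ lam * (γ * (Fz - Fx + D)) :=
    mul_le_mul_of_nonneg_left h9 hl0.le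
  have h12 : lam ^ 2 * N ≤ 2 * (lam * N) := by nlinarith [mul_nonneg hl0.le hN]
  rw [h5, h6]
  nlinarith

/-- Uniform estimates on the forward-backward points over bounded sets of arguments. -/
theorem exists_forwardBackward_bounds (h1 : H1 f g) (h2 : H2 f g) (hν : 0 < ν) {R c M Γ : ℝ}
    (hR : 0 ≤ R) (hc : 0 ≤ c) (hM : 0 ≤ M) (hΓ : 0 < Γ) :
    ∃ r C c' : ℝ, 0 ≤ r ∧ 0 < C ∧ c ≤ c' ∧ ∀ (W : H →L[ℝ] H) (x : H) (γ : ℝ),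
      IsEquivalentMetric ν μ W → x ∈ dom g → (g x).toReal ≤ c → ‖x‖ ≤ R →
      ‖gateauxGradient f x‖ ≤ M → 0 < γ → γ ≤ Γ →
      ‖forwardBackward f g W x γ - x‖ ≤ r ∧ ‖forwardBackward f g W x γ - x‖ ^ 2 ≤ C * γ ∧
        (g (forwardBackward f g W x γ)).toReal ≤ c' := by
  obtain ⟨a, b, ha, hb, hab⟩ := h1.right.exists_minorant
  set C₀ := c + a + b * R with hC₀
  have hC₀' : 0 ≤ C₀ := by positivity
  set r := 1 + (Γ * (b + M) + Γ * C₀) / ν with hr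
  have hr0 : 0 ≤ r := by positivity
  -- With `n = ‖x - y‖`, the minorant of `g` gives `ν n² ≤ γ ((b + M) n + C₀)`. Bounding `γ` by `Γ`
  -- yields `n ≤ r`; reinserting `n ≤ r` yields the factor of `γ`, made positive by the `+ 1`. The
  -- last bound is `D ≥ 0`.
  refine ⟨r, ((b + M) * r + C₀ + 1) / ν, c + r * M, hr0, by positivity,
    by linarith [mul_nonneg hr0 hM], fun W x γ hW hx hgx hxR hgrad hγ hγΓ => ?_⟩
  have hN := metricNormSq_le_decrement h1 h2 hW hγ hx
  have hl := hW.lower (x - forwardBackward f g W x γ)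
  have hD0 := decrement_nonneg h1 h2 hW hγ hx
  have hmin := hab _ (forwardBackward_mem_dom (x := x) h1 hW hγ)
  rw [decrement] at hN hD0
  set y := forwardBackward f g W x γ
  rw [norm_sub_rev y x]
  set n := ‖x - y‖ with hn
  have hn0 : 0 ≤ n := norm_nonneg _
  have hin : ⟪x - y, gateauxGradient f x⟫_ℝ ≤ n * M :=
    (real_inner_le_norm _ _).trans (mul_le_mul_of_nonneg_left hgrad hn0)
  have hyn : ‖y‖ ≤ R + n := by
    have := norm_sub_le x (x - y)
    rw [sub_sub_cancel] at this
    linarith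
  have hD : (g x).toReal - (g y).toReal + ⟪x - y, gateauxGradient f x⟫_ℝ ≤ (b + M) * n + C₀ := by
    have := mul_le_mul_of_nonneg_left hyn hb
    linarith
  have hsq : ν * n ^ 2 ≤ γ * ((b + M) * n + C₀) :=
    hl.trans (hN.trans (mul_le_mul_of_nonneg_left hD hγ.le))
  have hnr : n ≤ r := by
    refine le_of_sq_le_linear hν (by positivity) (by positivity) (hsq.trans ?_)
    have : γ * ((b + M) * n + C₀) ≤ Γ * ((b + M) * n + C₀) :=
      mul_le_mul_of_nonneg_right hγΓ (by positivity)
    linarith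
  refine ⟨hnr, ?_, ?_⟩
  · rw [div_mul_eq_mul_div, le_div_iff₀ hν]
    have : (b + M) * n ≤ (b + M) * r := mul_le_mul_of_nonneg_left hnr (by positivity)
    nlinarith
  · have : n * M ≤ r * M := mul_le_mul_of_nonneg_right hnr hM
    linarith

end ForwardBackward

end ProximalSteps

section MetricSequences

variable {H : Type*} [NormedAddCommGroup H] [InnerProductSpace ℝ H]

/-! ### Quasi-decreasing metrics and Opial's lemma -/

section VariableMetric

/-- The difference `T = U - V` satisfies `0 ≤ T ≤ μ`, hence `‖T w‖² ≤ μ ⟪w, T w⟫`: test positivity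
at `w - T w / μ`. This upgrades convergence of the quadratic forms to strong convergence of the
operators. -/
theorem IsEquivalentMetric.norm_apply_sub_sq_le {ν μ ν' μ' : ℝ} {U V : H →L[ℝ] H}
    (hU : IsEquivalentMetric ν μ U) (hV : IsEquivalentMetric ν' μ' V) (hμ : 0 < μ)
    (hle : ∀ u, metricNormSq V u ≤ metricNormSq U u) (w : H) :
    ‖U w - V w‖ ^ 2 ≤ μ * (metricNormSq U w - metricNormSq V w) := by
  set T := U - V with hT
  have hTN : ∀ u, ⟪u, T u⟫_ℝ = metricNormSq U u - metricNormSq V u := by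
    intro u
    rw [hT, sub_apply, inner_sub_right]
    rfl
  have hsymm : ∀ u v, ⟪T u, v⟫_ℝ = ⟪u, T v⟫_ℝ := by
    intro u v
    simp only [hT, sub_apply, inner_sub_right, inner_sub_left, hU.symm, hV.symm]
  have h0 : 0 ≤ ⟪w - (1 / μ) • T w, T (w - (1 / μ) • T w)⟫_ℝ := by
    rw [hTN]
    exact sub_nonneg.2 (hle _)
  have h1 : ⟪T w, T (T w)⟫_ℝ ≤ μ * ‖T w‖ ^ 2 := by
    rw [hTN]
    linarith [hU.upper (T w), hV.nonneg (T w)]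
  have h2 : ⟪w - (1 / μ) • T w, T (w - (1 / μ) • T w)⟫_ℝ =
      ⟪w, T w⟫_ℝ - 2 * (1 / μ) * ‖T w‖ ^ 2 + (1 / μ) ^ 2 * ⟪T w, T (T w)⟫_ℝ := by
    simp only [map_sub, map_smul, inner_sub_left, inner_sub_right, real_inner_smul_left,
      real_inner_smul_right, ← hsymm w (T w), real_inner_self_eq_norm_sq]
    ring
  have h3 : (1 / μ) ^ 2 * ⟪T w, T (T w)⟫_ℝ ≤ 1 / μ * ‖T w‖ ^ 2 := by
    calc _ ≤ (1 / μ) ^ 2 * (μ * ‖T w‖ ^ 2) := mul_le_mul_of_nonneg_left h1 (by positivity)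
      _ = _ := by field_simp
  have h4 : 1 / μ * ‖T w‖ ^ 2 ≤ ⟪w, T w⟫_ℝ := by linarith
  rw [← hTN w]
  rw [one_div, inv_mul_le_iff₀ hμ] at h4
  exact h4

/-- Quasi-decreasing metrics converge pointwise in the strong topology. -/
theorem exists_tendsto_apply [CompleteSpace H] {ν μ : ℝ} {V : ℕ → H →L[ℝ] H} {η : ℕ → ℝ}
    (hV : ∀ k, IsEquivalentMetric ν μ (V k)) (hμ : 0 < μ) (hη : ∀ k, 0 ≤ η k) (hηs : Summable η)
    (h : ∀ k u, metricNormSq (V (k + 1)) u ≤ (1 + η k) * metricNormSq (V k) u) (w : H) :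
    ∃ u, Tendsto (fun k => V k w) atTop (𝓝 u) := by
  obtain ⟨Q, hQ1, hQ, hPQ⟩ := tendsto_prod_one_add hη hηs
  set P : ℕ → ℝ := fun k => ∏ j ∈ Finset.range k, (1 + η j) with hP
  have hP1 : ∀ k, 1 ≤ P k := one_le_prod_one_add hη
  have hP0 : ∀ k, 0 < P k := fun k => zero_lt_one.trans_le (hP1 k)
  have hPs : ∀ k, P (k + 1) = P k * (1 + η k) := fun k => Finset.prod_range_succ _ _
  have hQ0 : 0 < Q := zero_lt_one.trans_le hQ1
  -- The rescaled metrics are genuinely decreasing and keep uniform bounds, since the products lie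
  -- between `1` and `Q`.
  set U : ℕ → H →L[ℝ] H := fun k => (P k)⁻¹ • V k with hU
  have hUN : ∀ k u, metricNormSq (U k) u = (P k)⁻¹ * metricNormSq (V k) u := by
    intro k u
    simp only [metricNormSq, metricInner, hU, smul_apply,
      real_inner_smul_right]
  have hUm : ∀ k, IsEquivalentMetric (ν / Q) μ (U k) := by
    intro k
    refine ⟨div_pos (hV k).ν_pos hQ0, fun u v => ?_, fun u => ?_, fun u => ?_⟩
    · simp only [hU, smul_apply, real_inner_smul_left, real_inner_smul_right,
        (hV k).symm]
    · rw [hUN, div_eq_inv_mul, mul_assoc]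
      exact mul_le_mul (inv_anti₀ (hP0 k) (hPQ k)) ((hV k).lower u)
        (mul_nonneg (hV k).ν_pos.le (sq_nonneg _)) (inv_nonneg.2 (hP0 k).le)
    · rw [hUN]
      exact (mul_le_of_le_one_left ((hV k).nonneg u) (inv_le_one_of_one_le₀ (hP1 k))).trans
        ((hV k).upper u)
  have hanti : ∀ u, Antitone fun k => metricNormSq (U k) u := by
    refine fun u => antitone_nat_of_succ_le fun k => ?_
    have h1 : 0 < 1 + η k := by linarith [hη k]
    rw [hUN, hUN, hPs, mul_inv, mul_assoc]
    refine mul_le_mul_of_nonneg_left ?_ (inv_nonneg.2 (hP0 k).le)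
    rw [inv_mul_le_iff₀ h1]
    exact h k u
  have hqt := tendsto_atTop_ciInf (hanti w)
    ⟨0, by rintro _ ⟨k, rfl⟩; exact (hUm k).nonneg w⟩
  have hcauchy : CauchySeq fun k => U k w := by
    have hq := hqt.cauchySeq
    rw [Metric.cauchySeq_iff'] at hq ⊢
    intro ε hε
    obtain ⟨N, hN⟩ := hq (ε ^ 2 / μ) (by positivity)
    refine ⟨N, fun n hn => ?_⟩
    have h1 := hN n hn
    have h2 := (hUm N).norm_apply_sub_sq_le (hUm n) hμ (fun u => hanti u hn) w
    rw [dist_comm, Real.dist_eq, lt_div_iff₀ hμ] at h1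
    rw [dist_comm, dist_eq_norm]
    refine lt_of_pow_lt_pow_left₀ 2 hε.le (h2.trans_lt ?_)
    have := mul_le_mul_of_nonneg_right
      (le_abs_self (metricNormSq (U N) w - metricNormSq (U n) w)) hμ.le
    linarith
  obtain ⟨u, hu⟩ := cauchySeq_tendsto_of_complete hcauchy
  refine ⟨Q • u, (hQ.smul hu).congr fun k => ?_⟩
  simp only [hU, smul_apply]
  rw [smul_smul, mul_inv_cancel₀ (hP0 k).ne', one_smul]

theorem tendsto_inner_of_weak_of_strong {ι : Type*} {l : Filter ι} {x v : ι → H} {z u : H} {R : ℝ}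
    (hR : ∀ i, ‖x i‖ ≤ R) (hx : Tendsto (fun i => ⟪u, x i⟫_ℝ) l (𝓝 ⟪u, z⟫_ℝ))
    (hv : Tendsto v l (𝓝 u)) : Tendsto (fun i => ⟪v i, x i⟫_ℝ) l (𝓝 ⟪u, z⟫_ℝ) := by
  have h1 : Tendsto (fun i => ⟪v i - u, x i⟫_ℝ) l (𝓝 0) := by
    have h2 : Tendsto (fun i => ‖v i - u‖ * R) l (𝓝 0) := by
      simpa using (tendsto_iff_norm_sub_tendsto_zero.1 hv).mul_const R
    refine squeeze_zero_norm (fun i => ?_) h2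
    exact (norm_inner_le_norm _ _).trans (mul_le_mul_of_nonneg_left (hR i) (norm_nonneg _))
  have := h1.add hx
  rw [zero_add] at this
  refine this.congr fun i => ?_
  rw [← inner_add_left, sub_add_cancel]

/-- Opial's lemma for quasi-decreasing metrics. -/
theorem exists_weaklyConvergesTo [CompleteSpace H] {ν μ : ℝ} {V : ℕ → H →L[ℝ] H} {η : ℕ → ℝ}
    (hV : ∀ k, IsEquivalentMetric ν μ (V k)) (hμ : 0 < μ) (hη : ∀ k, 0 ≤ η k) (hηs : Summable η)
    (h : ∀ k u, metricNormSq (V (k + 1)) u ≤ (1 + η k) * metricNormSq (V k) u) {x : ℕ → H} {R : ℝ}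
    (hR : ∀ k, ‖x k‖ ≤ R) {S : Set H}
    (hconv : ∀ z ∈ S, ∃ L, Tendsto (fun k => metricNormSq (V k) (x k - z)) atTop (𝓝 L))
    (hclus : ∀ (U : Ultrafilter ℕ) (z : H), (U : Filter ℕ) ≤ atTop →
      Tendsto (fun k => toWeakSpace ℝ H (x k)) U (𝓝 (toWeakSpace ℝ H z)) → z ∈ S) :
    ∃ z ∈ S, WeaklyConvergesTo x z := by
  have huniq : ∀ (U₁ U₂ : Ultrafilter ℕ) (z₁ z₂ : H), (U₁ : Filter ℕ) ≤ atTop →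
      (U₂ : Filter ℕ) ≤ atTop →
      Tendsto (fun k => toWeakSpace ℝ H (x k)) U₁ (𝓝 (toWeakSpace ℝ H z₁)) →
      Tendsto (fun k => toWeakSpace ℝ H (x k)) U₂ (𝓝 (toWeakSpace ℝ H z₂)) → z₁ = z₂ := by
    intro U₁ U₂ z₁ z₂ hU₁ hU₂ hz₁ hz₂
    obtain ⟨L₁, hL₁⟩ := hconv z₁ (hclus U₁ z₁ hU₁ hz₁)
    obtain ⟨L₂, hL₂⟩ := hconv z₂ (hclus U₂ z₂ hU₂ hz₂)
    have hNz : ∀ z, ∃ L, Tendsto (fun k => metricNormSq (V k) z) atTop (𝓝 L) := by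
      intro z
      obtain ⟨u, hu⟩ := exists_tendsto_apply hV hμ hη hηs h z
      exact ⟨_, tendsto_const_nhds.inner hu⟩
    obtain ⟨A₁, hA₁⟩ := hNz z₁
    obtain ⟨A₂, hA₂⟩ := hNz z₂
    obtain ⟨u, hu⟩ := exists_tendsto_apply hV hμ hη hηs h (z₁ - z₂)
    -- Polarization: the difference of the squared distances to `z₁` and `z₂` is affine in `x k`, so
    -- these scalar products converge along the whole sequence. Both cluster points then have the
    -- same scalar product with `u`, the limit of `V k (z₁ - z₂)`.
    have hin : Tendsto (fun k => ⟪V k (z₁ - z₂), x k⟫_ℝ) atTop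
        (𝓝 ((A₁ - A₂ - (L₁ - L₂)) / 2)) := by
      refine (((hA₁.sub hA₂).sub (hL₁.sub hL₂)).div_const 2).congr fun k => ?_
      have e : ⟪V k (z₁ - z₂), x k⟫_ℝ =
          metricInner (V k) (x k) z₁ - metricInner (V k) (x k) z₂ := by
        rw [real_inner_comm, map_sub, inner_sub_right]
        rfl
      rw [e, (hV k).normSq_sub, (hV k).normSq_sub]
      ring
    have e₁ := tendsto_nhds_unique (hin.mono_left hU₁)
      (tendsto_inner_of_weak_of_strong hR (tendsto_toWeakSpace_iff.1 hz₁ u) (hu.mono_left hU₁))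
    have e₂ := tendsto_nhds_unique (hin.mono_left hU₂)
      (tendsto_inner_of_weak_of_strong hR (tendsto_toWeakSpace_iff.1 hz₂ u) (hu.mono_left hU₂))
    have e₃ : ⟪z₁ - z₂, u⟫_ℝ = 0 := by
      rw [real_inner_comm, inner_sub_right, ← e₁, ← e₂, sub_self]
    have hlow : ν * ‖z₁ - z₂‖ ^ 2 ≤ 0 := by
      rw [← e₃]
      exact ge_of_tendsto' (tendsto_const_nhds.inner hu) fun k => (hV k).lower _
    by_contra hne
    have := mul_pos (hV 0).ν_pos (pow_pos (norm_pos_iff.2 (sub_ne_zero.2 hne)) 2)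
    linarith
  obtain ⟨U, z, hU, hz⟩ := exists_ultrafilter_tendsto_toWeakSpace (l := atTop)
    (Eventually.of_forall hR)
  refine ⟨z, hclus U z hU hz, ?_⟩
  refine (isCompact_toWeakSpace_image (convex_closedBall (0 : H) R) Metric.isClosed_closedBall
    Metric.isBounded_closedBall).tendsto_nhds_of_unique_mapClusterPt
    (Eventually.of_forall fun k => Set.mem_image_of_mem _ (by simpa using hR k)) ?_
  rintro _ ⟨z', -, rfl⟩ hz'
  obtain ⟨U', hU', hUz'⟩ := mapClusterPt_iff_ultrafilter.1 hz'
  rw [huniq U' U z' z hU' hU hUz' hz]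

theorem bounds_of_mem_rayleigh_image {ν μ : ℝ} {W : H →L[ℝ] H} (hW : IsEquivalentMetric ν μ W) {s : ℝ}
    (hs : s ∈ (fun x : H => ⟪x, W x⟫_ℝ) '' Metric.sphere (0 : H) 1) : ν ≤ s ∧ s ≤ μ := by
  obtain ⟨x, hx, rfl⟩ := hs
  have hx1 : ‖x‖ = 1 := by simpa using hx
  have h1 := hW.lower x
  have h2 := hW.upper x
  rw [hx1, one_pow, mul_one] at h1 h2
  exact ⟨h1, h2⟩

theorem IsEquivalentMetric.eigenvalue_bounds [Nontrivial H] {ν μ : ℝ} {W : H →L[ℝ] H}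
    (hW : IsEquivalentMetric ν μ W) : ν ≤ minEigenvalue W ∧ minEigenvalue W ≤ maxEigenvalue W ∧
      maxEigenvalue W ≤ μ ∧ IsEquivalentMetric (minEigenvalue W) (maxEigenvalue W) W := by
  have hne : ((fun x : H => ⟪x, W x⟫_ℝ) '' Metric.sphere (0 : H) 1).Nonempty :=
    (NormedSpace.sphere_nonempty.2 zero_le_one).image _
  have hbb : BddBelow ((fun x : H => ⟪x, W x⟫_ℝ) '' Metric.sphere (0 : H) 1) :=
    ⟨ν, fun s hs => (bounds_of_mem_rayleigh_image hW hs).1⟩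
  have hba : BddAbove ((fun x : H => ⟪x, W x⟫_ℝ) '' Metric.sphere (0 : H) 1) :=
    ⟨μ, fun s hs => (bounds_of_mem_rayleigh_image hW hs).2⟩
  have hν : ν ≤ minEigenvalue W := le_csInf hne fun s hs => (bounds_of_mem_rayleigh_image hW hs).1
  have key : ∀ u : H, u ≠ 0 → ∃ s ∈ (fun x : H => ⟪x, W x⟫_ℝ) '' Metric.sphere (0 : H) 1,
      metricNormSq W u = s * ‖u‖ ^ 2 := by
    intro u hu
    have hn : ‖u‖ ≠ 0 := norm_ne_zero_iff.2 hu
    refine ⟨metricNormSq W (‖u‖⁻¹ • u), ⟨‖u‖⁻¹ • u, ?_, rfl⟩, ?_⟩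
    · rw [mem_sphere_zero_iff_norm, norm_smul, norm_inv, norm_norm, inv_mul_cancel₀ hn]
    · rw [metricNormSq_smul]
      field_simp
  refine ⟨hν, csInf_le_csSup hne hbb hba,
    csSup_le hne fun s hs => (bounds_of_mem_rayleigh_image hW hs).2,
    ⟨hW.ν_pos.trans_le hν, hW.symm, fun u => ?_, fun u => ?_⟩⟩
  · rcases eq_or_ne u 0 with rfl | hu
    · simp [metricNormSq, metricInner]
    · obtain ⟨s, hs, e⟩ := key u hu
      rw [e]
      exact mul_le_mul_of_nonneg_right (csInf_le hbb hs) (sq_nonneg _)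
  · rcases eq_or_ne u 0 with rfl | hu
    · simp [metricNormSq, metricInner]
    · obtain ⟨s, hs, e⟩ := key u hu
      rw [e]
      exact mul_le_mul_of_nonneg_right (le_csSup hba hs) (sq_nonneg _)

/-- Both conditions on the metrics turn a quasi-Fejér step in the metrics `W k` into one in a
quasi-decreasing sequence of metrics. -/
theorem exists_quasiDecreasing_metrics {ν μ : ℝ} {W : ℕ → H →L[ℝ] H} (hνμ : ν ≤ μ)
    (hW : ∀ k, IsEquivalentMetric ν μ (W k)) (h45 : H4 W ∨ H5 W) :
    ∃ (ν' μ' C c : ℝ) (V : ℕ → H →L[ℝ] H) (η : ℕ → ℝ), 0 < μ' ∧ 0 ≤ C ∧ 0 < c ∧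
      (∀ k, IsEquivalentMetric ν' μ' (V k)) ∧ (∀ k, 0 ≤ η k) ∧ Summable η ∧
      (∀ k u, metricNormSq (V (k + 1)) u ≤ (1 + η k) * metricNormSq (V k) u) ∧
      ∀ k u v e d, 0 ≤ e → 0 ≤ d → metricNormSq (W k) u ≤ metricNormSq (W k) v + e - d →
        metricNormSq (V (k + 1)) u ≤ (1 + η k) * metricNormSq (V k) v + C * e - c * d := by
  have hν := (hW 0).ν_pos
  have hμ := hν.trans_le hνμ
  rcases h45 with ⟨η, hη, hηs, h⟩ | h
  · have hη' : ∀ k, η k ≤ ∑' j, η j := fun k => hηs.le_tsum k fun j _ => hη j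
    -- Under `H4` the metrics themselves serve; `1 + η k` is at most `1 + ∑' j, η j` on the error
    -- and at least `1` on the gain.
    refine ⟨ν, μ, 1 + ∑' j, η j, 1, W, η, hμ, by linarith [hη 0, hη' 0], one_pos, hW, hη, hηs, h,
      fun k u v e d he hd hstep => (h k u).trans ?_⟩
    have h1 := mul_le_mul_of_nonneg_left hstep (show 0 ≤ 1 + η k by linarith [hη k])
    have h2 := mul_le_mul_of_nonneg_right (hη' k) he
    have h3 := mul_nonneg (hη k) hd
    linarith
  · have hdiff : ∀ k, 0 ≤ maxEigenvalue (W k) - minEigenvalue (W k) := by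
      intro k
      -- In the zero space the sphere is empty and both eigenvalues take the default value `0`.
      cases subsingleton_or_nontrivial H with
      | inl hs =>
        have : Metric.sphere (0 : H) 1 = ∅ := by
          ext x
          simp [Subsingleton.elim x 0]
        simp [maxEigenvalue, minEigenvalue, this]
      | inr hn => exact sub_nonneg.2 (hW k).eigenvalue_bounds.2.1
    -- Under `H5` the original norm serves. Passing to it costs the factor `M / m = 1 + (M - m) /
    -- m`, with `M`, `m` the extreme eigenvalues, and divides `e` and `d` by `m`, which lies between
    -- `ν` and `μ`.
    refine ⟨1, 1, 1 / ν, 1 / μ, fun _ => ContinuousLinearMap.id ℝ H,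
      fun k => (maxEigenvalue (W k) - minEigenvalue (W k)) / ν, one_pos, by positivity,
      by positivity, fun _ => isEquivalentMetric_id, fun k => div_nonneg (hdiff k) hν.le,
      h.div_const ν, fun k u => ?_, fun k u v e d he hd hstep => ?_⟩
    · have := mul_nonneg (div_nonneg (hdiff k) hν.le)
        (isEquivalentMetric_id.nonneg u)
      linarith
    · rw [metricNormSq_id, metricNormSq_id]
      cases subsingleton_or_nontrivial H with
      | inl hs =>
        rw [Subsingleton.elim u 0, Subsingleton.elim v 0] at hstep ⊢
        have h1 : d ≤ e := by linarith
        have h2 : 1 / μ * d ≤ 1 / ν * e :=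
          mul_le_mul (one_div_le_one_div_of_le hν hνμ) h1 hd (by positivity)
        rw [norm_zero]
        linarith
      | inr hn =>
        obtain ⟨b1, b2, b3, hm⟩ := (hW k).eigenvalue_bounds
        set m := minEigenvalue (W k)
        set M := maxEigenvalue (W k)
        have hm0 : 0 < m := hm.ν_pos
        have h1 : m * ‖u‖ ^ 2 ≤ M * ‖v‖ ^ 2 + e - d := by linarith [hm.lower u, hm.upper v]
        have h2 : ‖u‖ ^ 2 ≤ (M * ‖v‖ ^ 2 + e - d) / m := by
          rw [le_div_iff₀ hm0]
          linarith
        have h3 : (M * ‖v‖ ^ 2 + e - d) / m =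
            (1 + (M - m) / m) * ‖v‖ ^ 2 + 1 / m * e - 1 / m * d := by
          field_simp
          ring
        have h4 : (M - m) / m ≤ (M - m) / ν := div_le_div_of_nonneg_left (sub_nonneg.2 b2) hν b1
        have h5 : 1 / m * e ≤ 1 / ν * e :=
          mul_le_mul_of_nonneg_right (one_div_le_one_div_of_le hν b1) he
        have h6 : 1 / μ * d ≤ 1 / m * d :=
          mul_le_mul_of_nonneg_right (one_div_le_one_div_of_le hm0 (b2.trans b3)) hd
        have h7 := mul_le_mul_of_nonneg_right h4 (sq_nonneg ‖v‖)
        linarith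

end VariableMetric

/-! ### The backtracking grid -/

section LineSearch

/-- The candidate preceding `s` in the grid is `s / θ > s`; by maximality it was rejected, unless
`s` is the first candidate. -/
theorem of_isGreatest_grid {a θ s : ℝ} {T : ℝ → Prop} (hθ : θ ∈ Set.Ioo (0 : ℝ) 1)
    (hs : IsGreatest {s ∈ grid a θ | T s} s) :
    0 < s ∧ s ≤ a ∧ T s ∧ (s = a ∨ s / θ ≤ a ∧ ¬ T (s / θ)) := by
  obtain ⟨⟨⟨hs0, i, hi⟩, hT⟩, hmax⟩ := hs
  have ha : 0 < a := by
    rw [hi] at hs0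
    exact pos_of_mul_pos_left hs0 (pow_pos hθ.1 i).le
  have hle : ∀ j : ℕ, a * θ ^ j ≤ a := fun j =>
    mul_le_of_le_one_right ha.le (pow_le_one₀ hθ.1.le hθ.2.le)
  refine ⟨hs0, hi ▸ hle i, hT, ?_⟩
  cases i with
  | zero => exact Or.inl (by simpa using hi)
  | succ j =>
    have hsj : s / θ = a * θ ^ j := by
      rw [hi, pow_succ, ← mul_assoc, mul_div_cancel_right₀ _ hθ.1.ne']
    refine Or.inr ⟨hsj ▸ hle j, fun hT' => ?_⟩
    have h1 : s / θ ≤ s := hmax ⟨⟨div_pos hs0 hθ.1, j, hsj⟩, hT'⟩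
    have h2 : s < s / θ := (lt_div_iff₀ hθ.1).2 (mul_lt_of_lt_one_right hs0 hθ.2)
    exact absurd h1 (not_le.2 h2)

end LineSearch

end MetricSequences

/-! ### Runs of the algorithm: decrease of the objective and vanishing residuals -/

section SearchRuns

/-- A segment from a fixed point is cut into `n + 1` pieces shorter than the modulus for `ε = 1`,
with `n` uniform because `K` is bounded; the norm grows by at most `1` on each piece. This bounds
`∇f` on bounded sublevel sets of `g`. -/
theorem UniformContinuousOn.exists_norm_le {E F : Type*} [NormedAddCommGroup E] [NormedSpace ℝ E]
    [NormedAddCommGroup F] {φ : E → F} {K : Set E} (hφ : UniformContinuousOn φ K)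
    (hK : Convex ℝ K) (hb : Bornology.IsBounded K) : ∃ M, 0 ≤ M ∧ ∀ u ∈ K, ‖φ u‖ ≤ M := by
  rcases K.eq_empty_or_nonempty with rfl | ⟨u₀, hu₀⟩
  · exact ⟨0, le_rfl, fun u hu => hu.elim⟩
  obtain ⟨ρ, hρ, hunif⟩ := Metric.uniformContinuousOn_iff.1 hφ 1 one_pos
  obtain ⟨R, hR⟩ := hb.subset_closedBall u₀
  obtain ⟨n, hn⟩ := exists_nat_gt (R / ρ)
  have hn0 : (0 : ℝ) < n + 1 := by positivity
  refine ⟨‖φ u₀‖ + (n + 1), by positivity, fun u hu => ?_⟩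
  set p : ℕ → E := fun i => u₀ + ((i : ℝ) / (n + 1)) • (u - u₀) with hp
  have hpK : ∀ i ≤ n + 1, p i ∈ K := by
    intro i hi
    refine hK.add_smul_sub_mem hu₀ hu ⟨by positivity, ?_⟩
    rw [div_le_one hn0]
    exact_mod_cast hi
  have hstep : ∀ i, dist (p (i + 1)) (p i) < ρ := by
    intro i
    have e : p (i + 1) - p i = ((n : ℝ) + 1)⁻¹ • (u - u₀) := by
      simp only [hp, Nat.cast_add, Nat.cast_one, add_sub_add_left_eq_sub, ← sub_smul]
      congr 1
      field_simp
      ring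
    have h1 : ‖u - u₀‖ ≤ R := by simpa [dist_eq_norm] using hR hu
    rw [dist_eq_norm, e, norm_smul, Real.norm_of_nonneg (by positivity), inv_mul_lt_iff₀ hn0]
    rw [div_lt_iff₀ hρ] at hn
    nlinarith
  have hind : ∀ i ≤ n + 1, ‖φ (p i)‖ ≤ ‖φ u₀‖ + i := by
    intro i
    induction i with
    | zero => intro _; simp [hp]
    | succ i ih =>
      intro hi
      have h1 := ih (by omega)
      have h2 := hunif _ (hpK _ hi) _ (hpK i (by omega)) (hstep i)
      rw [dist_eq_norm] at h2
      have h3 := norm_le_norm_add_norm_sub' (φ (p (i + 1))) (φ (p i))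
      push_cast
      linarith
  have hlast : p (n + 1) = u := by
    simp only [hp, Nat.cast_add, Nat.cast_one]
    rw [div_self hn0.ne', one_smul, add_sub_cancel]
  have := hind (n + 1) le_rfl
  rw [hlast] at this
  exact_mod_cast this

variable {H : Type*} [NormedAddCommGroup H] [InnerProductSpace ℝ H]

/-- The real value of `f + g` on its domain. -/
def objective (f g : H → EReal) (u : H) : ℝ := (f u).toReal + (g u).toReal

section Sublevel

variable {f g : H → EReal}

theorem coe_objective (h1 : H1 f g) {u : H} (hu : u ∈ dom g) :
    f u + g u = (objective f g u : EReal) := by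
  rw [objective, EReal.coe_add, h1.left.coe_toReal (h1.dom_subset hu), h1.right.coe_toReal hu]

theorem mem_dom_of_add_lt_top (h1 : H1 f g) {u : H} (hu : f u + g u < ⊤) : u ∈ dom g := by
  by_contra hcon
  rw [dom, Set.mem_ofPred_eq, not_lt_top_iff] at hcon
  rw [hcon, EReal.add_top_of_ne_bot (h1.left.ne_bot u)] at hu
  exact lt_irrefl _ hu

theorem le_objective_of_mem_argmin (h1 : H1 f g) {z : H} (hzd : z ∈ dom g)
    (hz : z ∈ argmin fun u => f u + g u) {u : H} (hu : u ∈ dom g) :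
    objective f g z ≤ objective f g u := by
  have h2 : _ = _ := hz
  have h3 := h2.le.trans (iInf_le _ u)
  beta_reduce at h3
  rw [coe_objective h1 hzd, coe_objective h1 hu] at h3
  exact_mod_cast h3

theorem H1.isProperConvexLsc_add (h1 : H1 f g) : IsProperConvexLsc fun u => f u + g u := by
  obtain ⟨u, hu⟩ := h1.right.nonempty_dom
  exact h1.left.add h1.right ⟨u, h1.dom_subset hu, hu⟩

/-- The part of a sublevel set of `g` in a closed ball. -/
def boundedSublevel (g : H → EReal) (c R : ℝ) : Set H :=
  {u | g u ≤ (c : EReal)} ∩ Metric.closedBall 0 R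

theorem boundedSublevel_subset_dom {E : Type*} [NormedAddCommGroup E] (g : E → EReal) (c R : ℝ) :
    boundedSublevel g c R ⊆ dom g :=
  fun _ hu => lt_of_le_of_lt hu.1 (EReal.coe_lt_top c)

theorem mem_boundedSublevel (hg : IsProperConvexLsc g) {c R : ℝ} {u : H} (hu : u ∈ dom g)
    (hc : (g u).toReal ≤ c) (hR : ‖u‖ ≤ R) : u ∈ boundedSublevel g c R := by
  refine ⟨?_, by simpa using hR⟩
  rw [Set.mem_ofPred_eq, ← hg.coe_toReal hu]
  exact_mod_cast hc

theorem convex_boundedSublevel (hg : IsProperConvexLsc g) (c R : ℝ) :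
    Convex ℝ (boundedSublevel g c R) :=
  (hg.convex_sublevel c).inter (convex_closedBall 0 R)

/-- These sets are convex, closed and bounded, hence weakly compact, so `H2` applies to them. -/
theorem uniformContinuousOn_boundedSublevel [CompleteSpace H] (h1 : H1 f g) (h2 : H2 f g)
    (c R : ℝ) : UniformContinuousOn (gateauxGradient f) (boundedSublevel g c R) :=
  h2.uniformContinuousOn _ (boundedSublevel_subset_dom g c R)
    (isCompact_toWeakSpace_image (convex_boundedSublevel h1.right c R)
      ((h1.right.isClosed_sublevel c).inter Metric.isClosed_closedBall)
      (Metric.isBounded_closedBall.subset Set.inter_subset_right))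

end Sublevel

/-- A run of the algorithm with the consequences of the line searches that drive the convergence
analysis: the Armijo-type decrease, and a lower bound on the step parameters unless the gradients
vary too much at the last rejected trial. -/
structure IsSearchRun (f g : H → EReal) (W : ℕ → H →L[ℝ] H) (γ lam : ℕ → ℝ) (x y : ℕ → H)
    (ν μ δ θ Γ m : ℝ) : Prop extends IsVMFBS f g W γ lam x y where
  h1 : H1 f g
  h2 : H2 f g
  ν_pos : 0 < ν
  ν_le_μ : ν ≤ μ
  metric : ∀ k, IsEquivalentMetric ν μ (W k)
  δ_mem : δ ∈ Set.Ioo (0 : ℝ) 1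
  θ_mem : θ ∈ Set.Ioo (0 : ℝ) 1
  m_pos : 0 < m
  γ_le : ∀ k, γ k ≤ Γ
  armijo : ∀ k, ArmijoTest f g (W k) δ (x k) (γ k) (lam k)
  rejected :
    ((∀ k, m ≤ lam k) ∧ ∀ k, γ k = Γ ∨ γ k / θ ≤ Γ ∧
      δ * ν / (γ k / θ) * ‖forwardBackward f g (W k) (x k) (γ k / θ) - x k‖ <
        ‖gateauxGradient f (J f g (W k) (x k) (γ k / θ) (lam k)) - gateauxGradient f (x k)‖) ∨
    ((∀ k, m ≤ γ k) ∧ ∀ k, m ≤ lam k ∨ lam k / θ ≤ 1 ∧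
      δ * ν / γ k * ‖forwardBackward f g (W k) (x k) (γ k) - x k‖ <
        ‖gateauxGradient f (J f g (W k) (x k) (γ k) (lam k / θ)) - gateauxGradient f (x k)‖)

section Run

variable {f g : H → EReal} {W : ℕ → H →L[ℝ] H} {γ lam : ℕ → ℝ} {x y : ℕ → H}
  {ν μ δ θ Γ m : ℝ}

theorem IsVMFBS.x_succ_eq_J (h : IsVMFBS f g W γ lam x y) (k : ℕ) :
    x (k + 1) = J f g (W k) (x k) (γ k) (lam k) := by
  rw [h.x_succ, h.y_eq, J]

theorem IsSearchRun.Γ_pos (h : IsSearchRun f g W γ lam x y ν μ δ θ Γ m) : 0 < Γ :=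
  (h.γ_pos 0).trans_le (h.γ_le 0)

theorem IsSearchRun.norm_step (h : IsSearchRun f g W γ lam x y ν μ δ θ Γ m) (k : ℕ) :
    ‖x (k + 1) - x k‖ = lam k * ‖y k - x k‖ := by
  rw [h.x_succ, add_sub_cancel_left, norm_smul, Real.norm_of_nonneg (h.lam_pos k).le]

variable [CompleteSpace H]

theorem IsVMFBS.mem_dom (h : IsVMFBS f g W γ lam x y) (h1 : H1 f g)
    (hW : ∀ k, IsEquivalentMetric ν μ (W k)) (k : ℕ) : x k ∈ dom g := by
  induction k with
  | zero => exact h.x_zero_mem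
  | succ k ih =>
    rw [h.x_succ_eq_J]
    exact J_mem_dom h1 (hW k) (h.γ_pos k) ih (h.lam_pos k).le (h.lam_le_one k)

/-- Only two facts about the test of a rule matter: it implies the Armijo test, and it is implied by
the gradient test. The rules thus reduce to two patterns, according to the parameter searched. -/
theorem exists_isSearchRun (h1 : H1 f g) (h2 : H2 f g) (hν : 0 < ν) (hνμ : ν ≤ μ)
    (hW : ∀ k, IsEquivalentMetric ν μ (W k)) (halg : IsVMFBS f g W γ lam x y)
    (hls : LS1 f g W γ lam x ∨ LS2 f g W γ lam x ∨ LS3 f g W γ lam x ∨ LS4 f g W γ lam x) :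
    ∃ δ θ Γ m : ℝ, IsSearchRun f g W γ lam x y ν μ δ θ Γ m := by
  have hx := halg.mem_dom h1 hW
  have hl0 := halg.lam_pos
  have hl1 := halg.lam_le_one
  have hγ := halg.γ_pos
  have stepsize : ∀ (T : ℝ → ℕ → ℝ → ℝ → Prop), (∀ δ ∈ Set.Ioo (0 : ℝ) 1, ∀ k s, 0 < s →
        T δ k s (lam k) → ArmijoTest f g (W k) δ (x k) s (lam k)) →
      (∀ δ ∈ Set.Ioo (0 : ℝ) 1, ∀ k s, 0 < s →
        GradientTest f g (W k) δ (x k) s (lam k) → T δ k s (lam k)) →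
      ((0 < ⨅ k, lam k) ∧ (∀ k, lam k ≤ 1) ∧
        ∃ δ ∈ Set.Ioo (0 : ℝ) 1, ∃ θ ∈ Set.Ioo (0 : ℝ) 1, ∃ γbar : ℝ, 0 < γbar ∧
          ∀ k, IsGreatest {s ∈ grid γbar θ | T δ k s (lam k)} (γ k)) →
      ∃ δ θ Γ m : ℝ, IsSearchRun f g W γ lam x y ν μ δ θ Γ m := by
    rintro T hTA hGT ⟨hinf, -, δ, hδ, θ, hθ, Γ, hΓ, hgr⟩
    have hg := fun k => of_isGreatest_grid hθ (hgr k)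
    refine ⟨δ, θ, Γ, ⨅ k, lam k, halg, h1, h2, hν, hνμ, hW, hδ, hθ, hinf, fun k => (hg k).2.1,
      fun k => hTA δ hδ k _ (hγ k) (hg k).2.2.1, Or.inl ⟨fun k => ciInf_le
        ⟨0, by rintro _ ⟨j, rfl⟩; exact (hl0 j).le⟩ k, fun k => ?_⟩⟩
    refine (hg k).2.2.2.imp_right fun ⟨hle, hnT⟩ => ⟨hle, ?_⟩
    have hs := div_pos (hγ k) hθ.1
    by_contra! hcon
    exact hnT (hGT δ hδ k _ hs
      (gradientTest_of_norm_le h1 h2 (hW k) hs (hx k) hδ.1.le (hl0 k) (hl1 k) hcon))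
  have relaxation : ∀ (T : ℝ → ℕ → ℝ → ℝ → Prop),
      (∀ δ ∈ Set.Ioo (0 : ℝ) 1, ∀ k s, 0 < s → s ≤ 1 →
        T δ k (γ k) s → ArmijoTest f g (W k) δ (x k) (γ k) s) →
      (∀ δ ∈ Set.Ioo (0 : ℝ) 1, ∀ k s, 0 < s → s ≤ 1 →
        GradientTest f g (W k) δ (x k) (γ k) s → T δ k (γ k) s) →
      ((0 < ⨅ k, γ k) ∧ BddAbove (Set.range γ) ∧
        ∃ δ ∈ Set.Ioo (0 : ℝ) 1, ∃ θ ∈ Set.Ioo (0 : ℝ) 1, ∃ lbar ∈ Set.Ioc (0 : ℝ) 1,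
          ∀ k, IsGreatest {s ∈ grid lbar θ | T δ k (γ k) s} (lam k)) →
      ∃ δ θ Γ m : ℝ, IsSearchRun f g W γ lam x y ν μ δ θ Γ m := by
    rintro T hTA hGT ⟨hinf, ⟨Γ, hΓ⟩, δ, hδ, θ, hθ, lbar, hlbar, hgr⟩
    have hg := fun k => of_isGreatest_grid hθ (hgr k)
    -- One constant `m` must bound both `γ k` and those `lam k` accepted at the first trial, which
    -- equal `lbar`.
    refine ⟨δ, θ, Γ, min (⨅ k, γ k) lbar, halg, h1, h2, hν, hνμ, hW, hδ, hθ,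
      lt_min hinf hlbar.1, fun k => hΓ ⟨k, rfl⟩,
      fun k => hTA δ hδ k _ (hl0 k) (hl1 k) (hg k).2.2.1, Or.inr ⟨fun k => (min_le_left _ _).trans
        (ciInf_le ⟨0, by rintro _ ⟨j, rfl⟩; exact (hγ j).le⟩ k), fun k => ?_⟩⟩
    refine (hg k).2.2.2.imp (fun e => (min_le_right _ _).trans_eq e.symm) fun ⟨hle, hnT⟩ =>
      ⟨hle.trans hlbar.2, ?_⟩
    have hs := div_pos (hl0 k) hθ.1
    have hs1 := hle.trans hlbar.2
    by_contra! hcon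
    exact hnT (hGT δ hδ k _ hs hs1
      (gradientTest_of_norm_le h1 h2 (hW k) (hγ k) (hx k) hδ.1.le hs hs1 hcon))
  rcases hls with h | h | h | h
  · exact stepsize (fun δ k s l => DescentTest f g (W k) δ (x k) s l)
      (fun δ hδ k s hs h => h.armijoTest h1 h2 (hW k) hs (hx k) hδ.1.le (hl0 k) (hl1 k))
      (fun δ hδ k s hs h => h.descentTest h1 h2 (hW k) hs (hx k) (hl0 k) (hl1 k)) h
  · exact relaxation (fun δ k s l => DescentTest f g (W k) δ (x k) s l)
      (fun δ hδ k s hs hs1 h => h.armijoTest h1 h2 (hW k) (hγ k) (hx k) hδ.1.le hs hs1)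
      (fun δ hδ k s hs hs1 h => h.descentTest h1 h2 (hW k) (hγ k) (hx k) hs hs1) h
  · exact relaxation (fun δ k s l => ArmijoTest f g (W k) δ (x k) s l)
      (fun δ hδ k s hs hs1 h => h)
      (fun δ hδ k s hs hs1 h => (h.descentTest h1 h2 (hW k) (hγ k) (hx k) hs hs1).armijoTest
        h1 h2 (hW k) (hγ k) (hx k) hδ.1.le hs hs1) h
  · exact stepsize (fun δ k s l => GradientTest f g (W k) δ (x k) s l)
      (fun δ hδ k s hs h => (h.descentTest h1 h2 (hW k) hs (hx k) (hl0 k) (hl1 k)).armijoTest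
        h1 h2 (hW k) hs (hx k) hδ.1.le (hl0 k) (hl1 k))
      (fun δ hδ k s hs h => h) h

namespace IsSearchRun

theorem mem_dom' (h : IsSearchRun f g W γ lam x y ν μ δ θ Γ m) (k : ℕ) : x k ∈ dom g :=
  h.mem_dom h.h1 h.metric k

theorem y_mem_dom (h : IsSearchRun f g W γ lam x y ν μ δ θ Γ m) (k : ℕ) : y k ∈ dom g := by
  rw [h.y_eq]
  exact forwardBackward_mem_dom h.h1 (h.metric k) (h.γ_pos k)

theorem decrease (h : IsSearchRun f g W γ lam x y ν μ δ θ Γ m) (k : ℕ) :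
    (1 - δ) * lam k * decrement f g (W k) (x k) (γ k) ≤
      objective f g (x k) - objective f g (x (k + 1)) := by
  rw [h.x_succ_eq_J]
  exact (armijoTest_iff h.h1 (h.metric k) (h.γ_pos k) (h.mem_dom' k) (h.lam_pos k)
    (h.lam_le_one k)).1 (h.armijo k)

theorem antitone_objective (h : IsSearchRun f g W γ lam x y ν μ δ θ Γ m) :
    Antitone fun k => objective f g (x k) := by
  refine antitone_nat_of_succ_le fun k => ?_
  have h3 : 0 ≤ 1 - δ := sub_nonneg.2 h.δ_mem.2.le
  have := mul_nonneg (mul_nonneg h3 (h.lam_pos k).le)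
    (decrement_nonneg h.h1 h.h2 (h.metric k) (h.γ_pos k) (h.mem_dom' k))
  linarith [h.decrease k]

/-- Combines `ν ‖x k - y k‖² ≤ Γ D` with the decrease, using `lam k ^ 2 ≤ lam k`. -/
theorem norm_step_sq_le (h : IsSearchRun f g W γ lam x y ν μ δ θ Γ m) (k : ℕ) :
    ‖x (k + 1) - x k‖ ^ 2 ≤
      Γ / ((1 - δ) * ν) * (objective f g (x k) - objective f g (x (k + 1))) := by
  have hδ : 0 < 1 - δ := sub_pos.2 h.δ_mem.2
  have hd := h.decrease k
  have hN := metricNormSq_le_decrement h.h1 h.h2 (h.metric k) (h.γ_pos k) (h.mem_dom' k)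
  have hD := decrement_nonneg h.h1 h.h2 (h.metric k) (h.γ_pos k) (h.mem_dom' k)
  have hlow := (h.metric k).lower (x k - y k)
  rw [← h.y_eq] at hN
  rw [h.norm_step, mul_pow, norm_sub_rev]
  set D := decrement f g (W k) (x k) (γ k)
  have hl0 := h.lam_pos k
  have hl1 := h.lam_le_one k
  have e1 : ν * ‖x k - y k‖ ^ 2 ≤ Γ * D :=
    hlow.trans (hN.trans (mul_le_mul_of_nonneg_right (h.γ_le k) hD))
  have e2 : lam k ^ 2 * ‖x k - y k‖ ^ 2 ≤ lam k * ‖x k - y k‖ ^ 2 :=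
    mul_le_mul_of_nonneg_right (by nlinarith) (sq_nonneg _)
  have e3 : lam k * (ν * ‖x k - y k‖ ^ 2) ≤ lam k * (Γ * D) := mul_le_mul_of_nonneg_left e1 hl0.le
  have e4 := mul_le_mul_of_nonneg_left hd h.Γ_pos.le
  rw [div_mul_eq_mul_div, le_div_iff₀ (mul_pos hδ h.ν_pos)]
  have e5 := mul_le_mul_of_nonneg_right e2 (mul_pos hδ h.ν_pos).le
  have e6 := mul_le_mul_of_nonneg_left e3 hδ.le
  linarith

theorem summable_objective_sub (h : IsSearchRun f g W γ lam x y ν μ δ θ Γ m) {b : ℝ}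
    (hb : ∀ k, b ≤ objective f g (x k)) :
    Summable fun k => objective f g (x k) - objective f g (x (k + 1)) := by
  refine summable_of_sum_range_le (c := objective f g (x 0) - b)
    (fun k => sub_nonneg.2 (h.antitone_objective k.le_succ)) fun n => ?_
  rw [Finset.sum_range_sub']
  linarith [hb n]

theorem summable_norm_step_sq (h : IsSearchRun f g W γ lam x y ν μ δ θ Γ m) {b : ℝ}
    (hb : ∀ k, b ≤ objective f g (x k)) : Summable fun k => ‖x (k + 1) - x k‖ ^ 2 :=
  ((h.summable_objective_sub hb).mul_left _).of_nonneg_of_le (fun _ => sq_nonneg _)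
    h.norm_step_sq_le

theorem tendsto_norm_step (h : IsSearchRun f g W γ lam x y ν μ δ θ Γ m) {b : ℝ}
    (hb : ∀ k, b ≤ objective f g (x k)) : Tendsto (fun k => ‖x (k + 1) - x k‖) atTop (𝓝 0) := by
  have := (h.summable_norm_step_sq hb).tendsto_atTop_zero.sqrt
  simpa using this

/-- Along bounded iterates, the residuals `‖y k - x k‖ / γ k` vanish. -/
theorem residual (h : IsSearchRun f g W γ lam x y ν μ δ θ Γ m) {b : ℝ}
    (hb : ∀ k, b ≤ objective f g (x k)) {l : Filter ℕ} (hl : l ≤ atTop) {R : ℝ} (hR0 : 0 ≤ R)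
    (hR : ∀ᶠ k in l, ‖x k‖ ≤ R) :
    ∃ c' R' : ℝ, (∀ᶠ k in l, x k ∈ boundedSublevel g c' R' ∧ y k ∈ boundedSublevel g c' R') ∧
      ∀ ε > 0, ∀ᶠ k in l, ‖y k - x k‖ ≤ ε * γ k := by
  obtain ⟨a₁, b₁, ha₁, hb₁, hab⟩ := h.h1.left.exists_minorant
  -- On the ball, `f` is bounded below by its minorant, so `F (x k) ≤ F (x 0)` bounds `g (x k)`. The
  -- iterates, their forward-backward points and all trials then lie in one bounded sublevel set
  -- `K`.
  set c := max 0 (objective f g (x 0) + (a₁ + b₁ * R)) with hc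
  have hxc : ∀ k, ‖x k‖ ≤ R → (g (x k)).toReal ≤ c := by
    intro k hk
    have e1 := h.antitone_objective (Nat.zero_le k)
    have e2 := hab (x k) (h.h1.dom_subset (h.mem_dom' k))
    have e3 := mul_le_mul_of_nonneg_left hk hb₁
    have e4 : objective f g (x k) = (f (x k)).toReal + (g (x k)).toReal := rfl
    refine le_trans ?_ (le_max_right _ _)
    simp only at e1
    linarith
  obtain ⟨M, hM, hgrad⟩ := UniformContinuousOn.exists_norm_le
    (uniformContinuousOn_boundedSublevel h.h1 h.h2 c R) (convex_boundedSublevel h.h1.right c R)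
    (Metric.isBounded_closedBall.subset Set.inter_subset_right)
  obtain ⟨r, C, c', hr, hC, hcc', hfb⟩ := exists_forwardBackward_bounds h.h1 h.h2 h.ν_pos hR0
    (le_max_left _ _ : 0 ≤ c) hM h.Γ_pos
  set K := boundedSublevel g c' (R + r) with hK
  have hKconv : Convex ℝ K := convex_boundedSublevel h.h1.right c' (R + r)
  have hxK : ∀ k, ‖x k‖ ≤ R → x k ∈ K := fun k hk => mem_boundedSublevel h.h1.right (h.mem_dom' k)
    ((hxc k hk).trans hcc') (by linarith)
  have hbd : ∀ k s, ‖x k‖ ≤ R → 0 < s → s ≤ Γ →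
      ‖forwardBackward f g (W k) (x k) s - x k‖ ^ 2 ≤ C * s ∧
        forwardBackward f g (W k) (x k) s ∈ K := by
    intro k s hk hs hsΓ
    obtain ⟨e1, e2, e3⟩ := hfb (W k) (x k) s (h.metric k) (h.mem_dom' k) (hxc k hk) hk
      (hgrad _ (mem_boundedSublevel h.h1.right (h.mem_dom' k) (hxc k hk) hk)) hs hsΓ
    refine ⟨e2, mem_boundedSublevel h.h1.right (forwardBackward_mem_dom h.h1 (h.metric k) hs) e3 ?_⟩
    have := norm_le_norm_add_norm_sub' (forwardBackward f g (W k) (x k) s) (x k)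
    linarith
  have hJK : ∀ k s t, ‖x k‖ ≤ R → 0 < s → s ≤ Γ → 0 ≤ t → t ≤ 1 →
      J f g (W k) (x k) s t ∈ K := by
    intro k s t hk hs hsΓ ht0 ht1
    rw [J_eq]
    exact hKconv (hxK k hk) (hbd k s hk hs hsΓ).2 (sub_nonneg.2 ht1) ht0 (by ring)
  have hunif := Metric.uniformContinuousOn_iff.1
    (uniformContinuousOn_boundedSublevel h.h1 h.h2 c' (R + r))
  refine ⟨c', R + r, ?_, fun ε hε => ?_⟩
  · filter_upwards [hR] with k hk
    refine ⟨hxK k hk, ?_⟩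
    rw [h.y_eq]
    exact (hbd k _ hk (h.γ_pos k) (h.γ_le k)).2
  have hν := h.ν_pos
  have hδ := h.δ_mem.1
  have hθ := h.θ_mem.1
  have hm := h.m_pos
  have hstep := h.tendsto_norm_step hb
  have hμ : 0 < μ := hν.trans_le h.ν_le_μ
  rcases h.rejected with ⟨hlam, hrej⟩ | ⟨hγm, hrej⟩
  · set κ := Real.sqrt μ / Real.sqrt ν with hκ
    have hsν : 0 < Real.sqrt ν := Real.sqrt_pos.2 hν
    have hκ0 : 0 < κ := div_pos (Real.sqrt_pos.2 hμ) hsν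
    obtain ⟨ρ, hρ, huc⟩ := hunif (ε * θ * (δ * ν) / κ) (by positivity)
    -- Stepsize search. For `γ k ≥ γ₀`, the vanishing steps suffice because `lam k ≥ m`. For `γ k <
    -- γ₀`, the rejected stepsize `s = γ k / θ` satisfies `C * s < ρ ^ 2`, so its trial is within
    -- `ρ` of `x k`.
    set γ₀ := min Γ (θ * (ρ ^ 2 / C)) with hγ₀
    have hγ₀0 : 0 < γ₀ := lt_min h.Γ_pos (by positivity)
    filter_upwards [hR, hl (hstep.eventually_le_const (show 0 < ε * γ₀ * m by positivity))]
      with k hk hsk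
    have hgood : γ₀ ≤ γ k → ‖y k - x k‖ ≤ ε * γ k := by
      intro hge
      rw [h.norm_step] at hsk
      have e1 : m * ‖y k - x k‖ ≤ ε * γ₀ * m :=
        (mul_le_mul_of_nonneg_right (hlam k) (norm_nonneg _)).trans hsk
      have e2 : ‖y k - x k‖ ≤ ε * γ₀ := by
        refine le_of_mul_le_mul_left ?_ hm
        linarith
      exact e2.trans (mul_le_mul_of_nonneg_left hge hε.le)
    rcases hrej k with heq | ⟨hle, hlt⟩
    · exact hgood (heq ▸ min_le_left _ _)
    · rcases le_or_gt γ₀ (γ k) with hge | hsmall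
      · exact hgood hge
      · have hs := div_pos (h.γ_pos k) hθ
        set s := γ k / θ with hs_def
        have hγs : γ k ≤ s := (le_div_iff₀ hθ).2
          (mul_le_of_le_one_right (h.γ_pos k).le h.θ_mem.2.le)
        have hslt : s < ρ ^ 2 / C := by
          have := (lt_min_iff.1 hsmall).2
          rw [hs_def, div_lt_iff₀ hθ]
          linarith
        obtain ⟨e1, e2⟩ := hbd k s hk hs hle
        have e3 : ‖forwardBackward f g (W k) (x k) s - x k‖ < ρ := by
          refine lt_of_pow_lt_pow_left₀ 2 hρ.le (e1.trans_lt ?_)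
          rw [lt_div_iff₀ hC] at hslt
          linarith
        have e4 : dist (J f g (W k) (x k) s (lam k)) (x k) < ρ := by
          rw [dist_eq_norm, J_sub, norm_smul, Real.norm_of_nonneg (h.lam_pos k).le]
          exact (mul_le_of_le_one_left (norm_nonneg _) (h.lam_le_one k)).trans_lt e3
        have e5 := huc _ (hJK k s (lam k) hk hs hle (h.lam_pos k).le (h.lam_le_one k)) _
          (hxK k hk) e4
        rw [dist_eq_norm] at e5
        have e6 := hlt.trans e5
        -- Monotonicity in the stepsize transfers the estimate from the rejected point to `y k`; `κ`
        -- is the price of returning from the metric to the norm.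
        have e7 : ‖y k - x k‖ ≤ κ * ‖forwardBackward f g (W k) (x k) s - x k‖ := by
          have i1 := metricNormSq_forwardBackward_mono h.h1 h.h2 (h.metric k) (h.γ_pos k) hγs
            (h.mem_dom' k)
          rw [← h.y_eq] at i1
          have i2 := Real.sqrt_le_sqrt i1
          have i3 := (h.metric k).sqrt_mul_norm_le (x k - y k)
          have i4 := (h.metric k).metricNorm_le_sqrt_mul hμ.le
            (x k - forwardBackward f g (W k) (x k) s)
          have i5 := i3.trans (i2.trans i4)
          rw [norm_sub_rev, norm_sub_rev (forwardBackward f g (W k) (x k) s), hκ,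
            div_mul_eq_mul_div, le_div_iff₀ hsν]
          linarith
        rw [div_mul_eq_mul_div, div_lt_div_iff₀ hs hκ0] at e6
        have e8 : δ * ν * (κ * ‖forwardBackward f g (W k) (x k) s - x k‖) < δ * ν * (ε * γ k) := by
          have : ε * θ * (δ * ν) * s = δ * ν * (ε * γ k) := by
            rw [hs_def]
            field_simp
          linarith
        exact e7.trans (lt_of_mul_lt_mul_left e8 (by positivity)).le
  -- Relaxation search: the rejected trial lies at distance `‖x (k + 1) - x k‖ / θ` from `x k`,
  -- which tends to zero.
  · obtain ⟨ρ, hρ, huc⟩ := hunif (ε * (δ * ν)) (by positivity)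
    filter_upwards [hR, hl (hstep.eventually_le_const (show 0 < ε * m * m by positivity)),
      hl (hstep.eventually_lt_const (show 0 < θ * ρ by positivity))] with k hk hsk hsρ
    rw [h.norm_step] at hsk hsρ
    rcases hrej k with hge | ⟨hle, hlt⟩
    · have e1 : m * ‖y k - x k‖ ≤ ε * m * m :=
        (mul_le_mul_of_nonneg_right hge (norm_nonneg _)).trans hsk
      have e2 : ‖y k - x k‖ ≤ ε * m := by
        refine le_of_mul_le_mul_left ?_ hm
        linarith
      exact e2.trans (mul_le_mul_of_nonneg_left (hγm k) hε.le)
    · rw [← h.y_eq] at hlt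
      have hs := div_pos (h.lam_pos k) hθ
      have e4 : dist (J f g (W k) (x k) (γ k) (lam k / θ)) (x k) < ρ := by
        rw [dist_eq_norm, J_sub, norm_smul, Real.norm_of_nonneg hs.le, ← h.y_eq,
          div_mul_eq_mul_div, div_lt_iff₀ hθ]
        linarith
      have e5 := huc _ (hJK k (γ k) _ hk (h.γ_pos k) (h.γ_le k) hs.le hle) _ (hxK k hk) e4
      rw [dist_eq_norm] at e5
      have e6 := hlt.trans e5
      rw [div_mul_eq_mul_div, div_lt_iff₀ (h.γ_pos k)] at e6
      refine (lt_of_mul_lt_mul_left (a := δ * ν) ?_ (by positivity)).le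
      linarith

end IsSearchRun

end Run

end SearchRuns

/-! ### Asymptotic minimality and quasi-Fejér monotonicity -/

section Convergence

namespace IsSearchRun

variable {H : Type*} [NormedAddCommGroup H] [InnerProductSpace ℝ H] [CompleteSpace H]
  {f g : H → EReal} {W : ℕ → H →L[ℝ] H} {γ lam : ℕ → ℝ} {x y : ℕ → H} {ν μ δ θ Γ m : ℝ}

theorem tendsto_sub (h : IsSearchRun f g W γ lam x y ν μ δ θ Γ m) {b : ℝ}
    (hb : ∀ k, b ≤ objective f g (x k)) {l : Filter ℕ} (hl : l ≤ atTop) {R : ℝ} (hR0 : 0 ≤ R)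
    (hR : ∀ᶠ k in l, ‖x k‖ ≤ R) : Tendsto (fun k => y k - x k) l (𝓝 0) := by
  obtain ⟨_, _, -, hres⟩ := h.residual hb hl hR0 hR
  refine Metric.tendsto_nhds.2 fun ε hε => ?_
  filter_upwards [hres (ε / 2 / Γ) (div_pos (half_pos hε) h.Γ_pos)] with k hk
  rw [dist_zero_right]
  refine (hk.trans (mul_le_mul_of_nonneg_left (h.γ_le k)
    (div_pos (half_pos hε) h.Γ_pos).le)).trans_lt ?_
  rw [div_mul_cancel₀ _ h.Γ_pos.ne']
  exact half_lt_self hε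

/-- Along bounded iterates, the values at the forward-backward points minimize `f + g`. -/
theorem eventually_objective_le (h : IsSearchRun f g W γ lam x y ν μ δ θ Γ m) {b : ℝ}
    (hb : ∀ k, b ≤ objective f g (x k)) {l : Filter ℕ} (hl : l ≤ atTop) {R : ℝ} (hR0 : 0 ≤ R)
    (hR : ∀ᶠ k in l, ‖x k‖ ≤ R) {z : H} (hz : z ∈ dom g) {ε : ℝ} (hε : 0 < ε) :
    ∀ᶠ k in l, objective f g (y k) ≤ objective f g z + ε := by
  obtain ⟨c, R', hmem, hres⟩ := h.residual hb hl hR0 hR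
  have hμ : 0 < μ := h.ν_pos.trans_le h.ν_le_μ
  set B := ‖z‖ + |R'| + 1 with hB
  have hB0 : 0 < B := by positivity
  obtain ⟨ρ, hρ, huc⟩ := Metric.uniformContinuousOn_iff.1
    (uniformContinuousOn_boundedSublevel h.h1 h.h2 c R') (ε / (2 * B)) (by positivity)
  have hdist := Metric.tendsto_nhds.1 (h.tendsto_sub hb hl hR0 hR) ρ hρ
  filter_upwards [hmem, hres (ε / (2 * (μ * B))) (by positivity), hdist] with k hk hk2 hk3
  rw [dist_zero_right, ← dist_eq_norm] at hk3
  have hgr := huc _ hk.2 _ hk.1 hk3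
  rw [dist_eq_norm] at hgr
  have e1 := forwardBackward_variational h.h1 h.h2 (h.metric k) (h.γ_pos k) (h.mem_dom' k)
    (h.y_eq k) hz
  have e2 := h.h1.left.gradient_ineq (gateauxGradient_spec h.h2.differentiable (h.y_mem_dom k))
    (h.h1.dom_subset hz)
  have hzy : ‖z - y k‖ ≤ B := by
    have i1 : ‖y k‖ ≤ R' := by simpa using hk.2.2
    have i2 := norm_sub_le z (y k)
    have i3 := le_abs_self R'
    linarith
  -- The inequality is divided by `γ k` at the end, so smallness relative to `γ k` is required here;
  -- hence the residual estimate in that form.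
  have e3 : -(metricInner (W k) (z - y k) (x k - y k)) ≤ γ k * (ε / 2) := by
    have i1 : |metricInner (W k) (z - y k) (x k - y k)| ≤ μ * (‖z - y k‖ * ‖x k - y k‖) := by
      refine abs_le_of_sq_le_sq ?_ (by positivity)
      refine ((h.metric k).inner_sq_le _ _).trans ?_
      refine (mul_le_mul ((h.metric k).upper _) ((h.metric k).upper _) ((h.metric k).nonneg _)
        (by positivity)).trans_eq ?_
      ring
    have i2 : μ * (‖z - y k‖ * ‖x k - y k‖) ≤ μ * (B * (ε / (2 * (μ * B)) * γ k)) := by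
      rw [norm_sub_rev (x k)]
      exact mul_le_mul_of_nonneg_left (mul_le_mul hzy hk2 (norm_nonneg _) hB0.le) hμ.le
    have i3 : μ * (B * (ε / (2 * (μ * B)) * γ k)) = γ k * (ε / 2) := by field_simp
    linarith [neg_abs_le (metricInner (W k) (z - y k) (x k - y k))]
  have e4 : ⟪z - y k, gateauxGradient f (x k)⟫_ℝ - ⟪z - y k, gateauxGradient f (y k)⟫_ℝ ≤
      ε / 2 := by
    rw [← inner_sub_right]
    refine (real_inner_le_norm _ _).trans ?_
    rw [norm_sub_rev (gateauxGradient f (x k))]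
    refine (mul_le_mul hzy hgr.le (norm_nonneg _) hB0.le).trans_eq ?_
    field_simp
  have hγ := h.γ_pos k
  have e5 := mul_le_mul_of_nonneg_left e4 hγ.le
  have e6 := mul_le_mul_of_nonneg_left e2 hγ.le
  refine le_of_mul_le_mul_left ?_ hγ
  rw [objective, objective]
  linarith

/-- Weak cluster points along bounded iterates are minimizers. -/
theorem mem_argmin_of_tendsto (h : IsSearchRun f g W γ lam x y ν μ δ θ Γ m) {b : ℝ}
    (hb : ∀ k, b ≤ objective f g (x k)) {l : Filter ℕ} [l.NeBot] (hl : l ≤ atTop) {R : ℝ}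
    (hR0 : 0 ≤ R) (hR : ∀ᶠ k in l, ‖x k‖ ≤ R) {z : H}
    (hz : Tendsto (fun k => toWeakSpace ℝ H (x k)) l (𝓝 (toWeakSpace ℝ H z))) :
    z ∈ argmin fun u => f u + g u := by
  have hyz : Tendsto (fun k => toWeakSpace ℝ H (y k)) l (𝓝 (toWeakSpace ℝ H z)) := by
    rw [tendsto_toWeakSpace_iff] at hz ⊢
    intro w
    have h1 : Tendsto (fun k => ⟪w, y k - x k⟫_ℝ) l (𝓝 ⟪w, (0 : H)⟫_ℝ) :=
      tendsto_const_nhds.inner (h.tendsto_sub hb hl hR0 hR)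
    have h2 := (hz w).add h1
    rw [inner_zero_right, add_zero] at h2
    refine h2.congr fun k => ?_
    rw [← inner_add_right, add_sub_cancel]
  have hF := h.h1.isProperConvexLsc_add
  have key : ∀ u ∈ dom g, ∀ ε > 0, f z + g z ≤ ((objective f g u + ε : ℝ) : EReal) := by
    intro u hu ε hε
    refine mem_of_tendsto_toWeakSpace
      (K := {v | f v + g v ≤ ((objective f g u + ε : ℝ) : EReal)})
      (hF.convex_sublevel (objective f g u + ε))
      (hF.isClosed_sublevel _) hyz ?_
    filter_upwards [h.eventually_objective_le hb hl hR0 hR hu hε] with k hk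
    rw [coe_objective h.h1 (h.y_mem_dom k)]
    exact_mod_cast hk
  have hzd : z ∈ dom g := mem_dom_of_add_lt_top h.h1
    ((key _ h.x_zero_mem 1 one_pos).trans_lt (EReal.coe_lt_top _))
  refine le_antisymm (le_iInf fun u => ?_) (iInf_le _ z)
  beta_reduce
  by_cases hu : u ∈ dom g
  · rw [coe_objective h.h1 hzd, coe_objective h.h1 hu, EReal.coe_le_coe_iff]
    refine le_of_forall_pos_le_add fun ε hε => ?_
    have := key u hu ε hε
    rw [coe_objective h.h1 hzd] at this
    exact_mod_cast this
  · rw [dom, Set.mem_ofPred_eq, not_lt_top_iff] at hu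
    rw [hu, EReal.add_top_of_ne_bot (h.h1.left.ne_bot u)]
    exact le_top

/-- The point `z` need not be a minimizer, only lie below all the values along the iterates; the
case without minimizers relies on this. The metrics `V k` do not depend on `z`, as Opial's lemma
requires. -/
theorem fejer (h : IsSearchRun f g W γ lam x y ν μ δ θ Γ m) (h45 : H4 W ∨ H5 W) :
    ∃ (ν' μ' : ℝ) (V : ℕ → H →L[ℝ] H) (η : ℕ → ℝ), 0 < μ' ∧
      (∀ k, IsEquivalentMetric ν' μ' (V k)) ∧ (∀ k, 0 ≤ η k) ∧ Summable η ∧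
      (∀ k u, metricNormSq (V (k + 1)) u ≤ (1 + η k) * metricNormSq (V k) u) ∧
      ∀ z ∈ dom g, (∀ k, objective f g z ≤ objective f g (x k)) →
        (∃ L, Tendsto (fun k => metricNormSq (V k) (x k - z)) atTop (𝓝 L)) ∧
        (∃ R, 0 ≤ R ∧ ∀ k, ‖x k‖ ≤ R) ∧
        Summable fun k => γ k * lam k * (objective f g (x k) - objective f g z) := by
  obtain ⟨ν', μ', C, c, V, η, hμ', hC, hc, hV, hη, hηs, hVm, hstep⟩ :=
    exists_quasiDecreasing_metrics h.ν_le_μ h.metric h45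
  refine ⟨ν', μ', V, η, hμ', hV, hη, hηs, hVm, fun z hz hle => ?_⟩
  have hδ : 0 < 1 - δ := sub_pos.2 h.δ_mem.2
  set e : ℕ → ℝ := fun k => 2 * Γ / (1 - δ) * (objective f g (x k) - objective f g (x (k + 1)))
    with he
  set d : ℕ → ℝ := fun k => 2 * (γ k * lam k * (objective f g (x k) - objective f g z)) with hd
  have hdec : ∀ k, 0 ≤ objective f g (x k) - objective f g (x (k + 1)) := fun k =>
    sub_nonneg.2 (h.antitone_objective k.le_succ)
  have he0 : ∀ k, 0 ≤ e k := fun k =>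
    mul_nonneg (div_nonneg (mul_nonneg zero_le_two h.Γ_pos.le) hδ.le) (hdec k)
  have hd0 : ∀ k, 0 ≤ d k := fun k => mul_nonneg zero_le_two
    (mul_nonneg (mul_pos (h.γ_pos k) (h.lam_pos k)).le (sub_nonneg.2 (hle k)))
  have hineq : ∀ k, metricNormSq (W k) (x (k + 1) - z) ≤
      metricNormSq (W k) (x k - z) + e k - d k := by
    intro k
    have e1 := (h.armijo k).fejer h.h1 h.h2 (h.metric k) (h.γ_pos k) (h.mem_dom' k) h.δ_mem.2
      (h.lam_pos k) (h.lam_le_one k) hz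
    rw [← h.x_succ_eq_J] at e1
    have e2 : 2 * γ k / (1 - δ) * (objective f g (x k) - objective f g (x (k + 1))) ≤ e k :=
      mul_le_mul_of_nonneg_right (div_le_div_of_nonneg_right
        (mul_le_mul_of_nonneg_left (h.γ_le k) zero_le_two) hδ.le) (hdec k)
    simp only [objective, hd] at e2 ⊢
    linarith
  have hes : Summable e := (h.summable_objective_sub hle).mul_left _
  obtain ⟨⟨L, hL⟩, hs⟩ := quasiFejer (a := fun k => metricNormSq (V k) (x k - z))
    (b := fun k => c * d k) (e := fun k => C * e k) (fun k => (hV k).nonneg _)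
    (fun k => mul_nonneg hc.le (hd0 k)) (fun k => mul_nonneg hC (he0 k)) hη (hes.mul_left C) hηs
    (fun k => hstep k _ _ _ _ (he0 k) (hd0 k) (hineq k))
  refine ⟨⟨L, hL⟩, ?_, ?_⟩
  · obtain ⟨A, hA⟩ := hL.bddAbove_range
    have hν' := (hV 0).ν_pos
    refine ⟨Real.sqrt (A / ν') + ‖z‖, by positivity, fun k => ?_⟩
    have e1 : ‖x k - z‖ ≤ Real.sqrt (A / ν') := by
      refine Real.le_sqrt_of_sq_le ((le_div_iff₀ hν').2 ?_)
      have := (hV k).lower (x k - z)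
      have e2 : metricNormSq (V k) (x k - z) ≤ A := hA ⟨k, rfl⟩
      linarith
    linarith [norm_le_norm_add_norm_sub' (x k) z]
  · refine (hs.mul_left (1 / (2 * c))).congr fun k => ?_
    simp only [hd]
    field_simp

end IsSearchRun

end Convergence

end VMFBS

end

/-! ### The convergence theorem -/

theorem mainTheorem1 {H : Type*} [NormedAddCommGroup H] [InnerProductSpace ℝ H] [CompleteSpace H]
    (f g : H → EReal) (W : ℕ → H →L[ℝ] H) (γ lam : ℕ → ℝ) (x y : ℕ → H)
    (h1 : VMFBS.H1 f g) (h2 : VMFBS.H2 f g) (h3 : VMFBS.H3 W)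
    (h45 : VMFBS.H4 W ∨ VMFBS.H5 W)
    (halg : VMFBS.IsVMFBS f g W γ lam x y)
    (hls : VMFBS.LS1 f g W γ lam x ∨ VMFBS.LS2 f g W γ lam x ∨
      VMFBS.LS3 f g W γ lam x ∨ VMFBS.LS4 f g W γ lam x) :
    -- the objective values decrease
    Antitone (fun k => f (x k) + g (x k)) ∧
    (((⊥ : EReal) < ⨅ k, (f (x k) + g (x k))) → Summable fun k => ‖x (k + 1) - x k‖ ^ 2) ∧
    -- the case of a nonempty solution set
    ((VMFBS.argmin fun z => f z + g z).Nonempty →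
      (∃ z ∈ VMFBS.argmin (fun z => f z + g z),
        VMFBS.WeaklyConvergesTo x z ∧ VMFBS.WeaklyConvergesTo y z) ∧
      Tendsto (fun k => f (y k) + g (y k)) atTop (𝓝 (⨅ z, (f z + g z))) ∧
      (¬ Summable (fun k => γ k * lam k) →
        Tendsto (fun k => f (x k) + g (x k)) atTop (𝓝 (⨅ z, (f z + g z)))) ∧
      ((0 < ⨅ k, γ k * lam k) →
        ∃ r : ℕ → ℝ, (∀ k, f (x k) + g (x k) = (⨅ z, (f z + g z)) + (r k : EReal)) ∧
          r =o[atTop] fun k : ℕ => 1 / (k : ℝ))) ∧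
    -- the case of an empty solution set
    (VMFBS.argmin (fun z => f z + g z) = ∅ →
      Tendsto (fun k => ‖x k‖) atTop atTop ∧
      Tendsto (fun k => f (x k) + g (x k)) atTop (𝓝 (⨅ z, (f z + g z)))) := by
  obtain ⟨ν, μ, hν, hνμ, hW⟩ := h3.exists_isEquivalentMetric
  obtain ⟨δ, θ, Γ, m, h⟩ := VMFBS.exists_isSearchRun h1 h2 hν hνμ hW halg hls
  have hE : ∀ k, f (x k) + g (x k) = (VMFBS.objective f g (x k) : EReal) :=
    fun k => VMFBS.coe_objective h1 (h.mem_dom' k)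
  have hEy : ∀ k, f (y k) + g (y k) = (VMFBS.objective f g (y k) : EReal) :=
    fun k => VMFBS.coe_objective h1 (h.y_mem_dom k)
  have hanti : Antitone fun k => f (x k) + g (x k) := by
    intro i j hij
    simp only [hE]
    exact_mod_cast h.antitone_objective hij
  have hbdd : (⊥ : EReal) < ⨅ k, (f (x k) + g (x k)) → ∃ b : ℝ, ∀ k,
      b ≤ VMFBS.objective f g (x k) := by
    intro hlt
    obtain ⟨b, -, hb⟩ := EReal.lt_iff_exists_real_btwn.1 hlt
    refine ⟨b, fun k => ?_⟩
    have := hb.le.trans (iInf_le _ k)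
    rw [hE] at this
    exact_mod_cast this
  obtain ⟨ν', μ', V, η, hμ', hV, hη, hηs, hVm, hfejer⟩ := h.fejer h45
  refine ⟨hanti, fun hlt => ?_, ?_, fun hempty => ?_⟩
  · obtain ⟨b, hb⟩ := hbdd hlt
    exact h.summable_norm_step_sq hb
  · rintro ⟨zs, hzs⟩
    have hzs' : f zs + g zs = ⨅ z, (f z + g z) := hzs
    have hzd : zs ∈ VMFBS.dom g := by
      refine VMFBS.mem_dom_of_add_lt_top h1 ?_
      rw [hzs']
      refine (iInf_le _ (x 0)).trans_lt ?_
      rw [hE]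
      exact EReal.coe_lt_top _
    have hmin : ∀ u ∈ VMFBS.dom g, VMFBS.objective f g zs ≤ VMFBS.objective f g u := fun u hu =>
      VMFBS.le_objective_of_mem_argmin h1 hzd hzs hu
    have hb : ∀ k, VMFBS.objective f g zs ≤ VMFBS.objective f g (x k) :=
      fun k => hmin _ (h.mem_dom' k)
    obtain ⟨-, ⟨R, hR0, hR⟩, hsum⟩ := hfejer zs hzd hb
    have hRl : ∀ l : Filter ℕ, ∀ᶠ k in l, ‖x k‖ ≤ R := fun l => Eventually.of_forall hR
    rw [← hzs', VMFBS.coe_objective h1 hzd]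
    have hnn : ∀ k, 0 ≤ VMFBS.objective f g (x k) - VMFBS.objective f g zs :=
      fun k => sub_nonneg.2 (hb k)
    refine ⟨?_, ?_, ?_, ?_⟩
    · obtain ⟨z, hz, hxz⟩ := VMFBS.exists_weaklyConvergesTo hV hμ' hη hηs hVm hR
        (S := VMFBS.argmin (fun z => f z + g z) ∩ VMFBS.dom g)
        (fun z hz => (hfejer z hz.2 fun k =>
          VMFBS.le_objective_of_mem_argmin h1 hz.2 hz.1 (h.mem_dom' k)).1)
        (fun U z hU hz => by
          have hza := h.mem_argmin_of_tendsto hb hU hR0 (hRl _) hz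
          refine ⟨hza, VMFBS.mem_dom_of_add_lt_top h1 ?_⟩
          have hza' : f z + g z = _ := hza
          rw [hza', ← hzs', VMFBS.coe_objective h1 hzd]
          exact EReal.coe_lt_top _)
      refine ⟨z, hz.1, hxz, ?_⟩
      have hsub := h.tendsto_sub hb le_rfl hR0 (hRl _)
      rw [VMFBS.WeaklyConvergesTo, VMFBS.tendsto_toWeakSpace_iff] at hxz ⊢
      intro w
      have e1 := (hxz w).add ((tendsto_const_nhds (x := w)).inner hsub)
      rw [inner_zero_right, add_zero] at e1
      refine e1.congr fun k => ?_
      rw [← inner_add_right, add_sub_cancel]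
    · simp only [hEy]
      refine EReal.tendsto_coe.2 (tendsto_order.2 ⟨fun a ha => Eventually.of_forall fun k =>
        ha.trans_le (hmin _ (h.y_mem_dom k)), fun a ha => ?_⟩)
      filter_upwards [h.eventually_objective_le hb le_rfl hR0 (hRl _) hzd
        (half_pos (sub_pos.2 ha))] with k hk
      linarith
    · intro hns
      simp only [hE]
      refine EReal.tendsto_coe.2 (tendsto_order.2 ⟨fun a ha => Eventually.of_forall fun k =>
        ha.trans_le (hb k), fun a ha => ?_⟩)
      -- Otherwise, by monotonicity, all values stay above `a > min F`, and summability of `γ k *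
      -- lam k * (F (x k) - min F)` would make `γ k * lam k` summable.
      by_contra hcon
      have hall : ∀ k, a ≤ VMFBS.objective f g (x k) := by
        intro k
        by_contra! hlt
        exact hcon ((eventually_ge_atTop k).mono fun j hj =>
          (h.antitone_objective hj).trans_lt hlt)
      have hpos := sub_pos.2 ha
      refine hns ((hsum.mul_left (a - VMFBS.objective f g zs)⁻¹).of_nonneg_of_le
        (fun k => (mul_pos (h.γ_pos k) (h.lam_pos k)).le) fun k => ?_)
      rw [le_inv_mul_iff₀ hpos, mul_comm]
      exact mul_le_mul_of_nonneg_left (sub_le_sub_right (hall k) _)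
        (mul_pos (h.γ_pos k) (h.lam_pos k)).le
    · intro hinf
      refine ⟨fun k => VMFBS.objective f g (x k) - VMFBS.objective f g zs, fun k => ?_, ?_⟩
      · rw [hE, ← EReal.coe_add, add_sub_cancel]
      · refine VMFBS.isLittleO_of_antitone_summable
          (fun i j hij => sub_le_sub_right (h.antitone_objective hij) _)
          ((hsum.mul_left (⨅ k, γ k * lam k)⁻¹).of_nonneg_of_le hnn fun k => ?_)
        rw [le_inv_mul_iff₀ hinf]
        refine mul_le_mul_of_nonneg_right (ciInf_le ⟨0, ?_⟩ k) (hnn k)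
        rintro _ ⟨j, rfl⟩
        exact (mul_pos (h.γ_pos j) (h.lam_pos j)).le
  · have hnorm : Tendsto (fun k => ‖x k‖) atTop atTop := by
      by_contra hcon
      rw [tendsto_atTop] at hcon
      push Not at hcon
      obtain ⟨R, hR⟩ := hcon
      -- If the norms do not diverge, some ball is visited infinitely often; `l` restricts to these
      -- visits.
      set l := atTop ⊓ 𝓟 {k | ‖x k‖ ≤ max R 0} with hl
      have hne : l.NeBot := by
        rw [hl, ← frequently_mem_iff_neBot]
        exact hR.mono fun k hk => hk.le.trans (le_max_left _ _)
      have hlR : ∀ᶠ k in l, ‖x k‖ ≤ max R 0 := mem_inf_of_right (mem_principal_self _)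
      have hR0 : 0 ≤ max R 0 := le_max_right _ _
      -- Each value dominates the value at a later visit to the ball, where the minorants of `f` and
      -- `g` are bounded below.
      have hb : ∃ b : ℝ, ∀ k, b ≤ VMFBS.objective f g (x k) := by
        obtain ⟨a₁, b₁, -, hb₁, hf⟩ := h1.left.exists_minorant
        obtain ⟨a₂, b₂, -, hb₂, hg⟩ := h1.right.exists_minorant
        refine ⟨-(a₁ + b₁ * max R 0) + -(a₂ + b₂ * max R 0), fun k => ?_⟩
        obtain ⟨j, hjk, hj⟩ := frequently_atTop.1 hR k
        have hj' := hj.le.trans (le_max_left R 0)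
        refine le_trans ?_ (h.antitone_objective hjk)
        have e1 := hf _ (h1.dom_subset (h.mem_dom' j))
        have e2 := hg _ (h.mem_dom' j)
        have e3 := mul_le_mul_of_nonneg_left hj' hb₁
        have e4 := mul_le_mul_of_nonneg_left hj' hb₂
        change _ ≤ (f (x j)).toReal + (g (x j)).toReal
        linarith
      obtain ⟨b, hb⟩ := hb
      obtain ⟨U, z, hU, hz⟩ := VMFBS.exists_ultrafilter_tendsto_toWeakSpace hlR
      have := h.mem_argmin_of_tendsto hb (hU.trans inf_le_left) hR0 (hU hlR) hz
      rw [hempty] at this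
      exact this
    refine ⟨hnorm, ?_⟩
    have hlim := tendsto_atTop_iInf hanti
    suffices heq : ⨅ k, (f (x k) + g (x k)) = ⨅ z, (f z + g z) by rwa [heq] at hlim
    refine le_antisymm ?_ (le_iInf fun k => iInf_le _ (x k))
    by_contra! hlt
    obtain ⟨z, hz⟩ := iInf_lt_iff.1 hlt
    have hzd : z ∈ VMFBS.dom g := VMFBS.mem_dom_of_add_lt_top h1 (hz.trans_le le_top)
    rw [VMFBS.coe_objective h1 hzd] at hz
    -- A point strictly below all the values would make the iterates bounded, against `hnorm`.
    obtain ⟨-, ⟨R, -, hR⟩, -⟩ := hfejer z hzd fun k => by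
      have := hz.le.trans (iInf_le _ k)
      rw [hE] at this
      exact_mod_cast this
    obtain ⟨k, hk⟩ := (hnorm.eventually_gt_atTop R).exists
    exact absurd (hR k) (not_le.2 hk)
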